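/- For integers $k\ge 1$, $q\ge 1$ let $W_{k,q}=\{v\in\mathbb Z^{k-1}: 0\le v_1\le\cdots\le v_{k-1}\le q\}$. The edgewise subdivision $T_{k,q}$ is the simplicial complex on $W_{k,q}$ whose facets are the sets $$F(v,\pi)=\{v,\ v+e_{\pi_{k-1}},\ v+e_{\pi_{k-1}}+e_{\pi_{k-2}},\ \ldots,\ v+e_{\pi_{k-1}}+\cdots+e_{\pi_1}=v+\mathbb 1\},$$ where $v$ and $v+\mathbb 1$ lie in $W_{k,q}$ and $\pi$ is a permutation of $\{1,\ldots,k-1\}$ in which $i$ occurs before $i+1$ whenever $v_i=v_{i+1}$. The link of a face $\sigma$ of a complex $K$ consists of the faces $\tau$ with $\sigma\cup\tau\in K$ and $\sigma\cap\tau=\emptyset$. Two complexes have the same combinatorial type if some bijection between their vertex sets maps faces exactly to faces. For a partition $\sigma=(\sigma_1,\ldots,\sigma_r)$ of a positive integer let $K_\sigma$ be the complex of chains of the poset obtained from the product of chains $\{0,\ldots,\sigma_1\}\times\cdots\times\{0,\ldots,\sigma_r\}$ by removing its minimum and its maximum. For $s\ge 0$ let $Q_s$ be the number of combinatorial types of $s$-dimensional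 complexes that are joins of finitely many complexes $K_\sigma$, where each partition $\sigma$ has at least two parts. Theorem. For every integer $m\ge 0$, the number of combinatorial types of links of $m$-dimensional faces of $T_{2m+2,2m+2}$ is $$Q_m+Q_{m-1}+\cdots+Q_1+Q_0+1.$$ Moreover, for every $s\ge 0$, $$Q_s=\sum_{\mu}\ \prod_{i=1}^{j}\left(\!\!\binom{p_{n_i+1}-1}{m_i}\!\!\right),$$ where the sum is over all partitions $\mu=(n_1^{m_1},\ldots,n_j^{m_j})$ of $s+1$ (distinct parts $n_1,\ldots,n_j$ with multiplicities $m_1,\ldots,m_j\ge 1$), $p_n$ is the number of partitions of $n$, and $\left(\!\binom{a}{b}\!\right)=\binom{a+b-1}{b}$ is the number of multisets of size $b$ from a set of $a$ elements. -/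

import Mathlib

/-! ### Abstract simplicial complexes up to combinatorial equivalence

Complexes are Mathlib's `PreAbstractSimplicialComplex`: the faces are the nonempty ones, and not
every element of the ambient type has to be a vertex. -/

namespace EdgewiseSubdivision

/-- The vertices of a complex. -/
def vertexSet {V : Type*} (K : PreAbstractSimplicialComplex V) : Set V :=
  {v | ({v} : Finset V) ∈ K.faces}

/-- Two complexes are combinatorially equivalent if there is a bijection between their vertices
that maps faces exactly to faces. -/
def CombEquiv {V W : Type*} (K : PreAbstractSimplicialComplex V)
    (L : PreAbstractSimplicialComplex W) : Prop :=
  ∃ f : vertexSet K ≃ vertexSet L, ∀ s : Finset (vertexSet K),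
    s.map (Function.Embedding.subtype _) ∈ K.faces ↔
      (s.map f.toEmbedding).map (Function.Embedding.subtype _) ∈ L.faces

theorem CombEquiv.refl {V : Type*} (K : PreAbstractSimplicialComplex V) : CombEquiv K K :=
  ⟨Equiv.refl _, fun s => by simp⟩

theorem CombEquiv.symm {V W : Type*} {K : PreAbstractSimplicialComplex V}
    {L : PreAbstractSimplicialComplex W} (h : CombEquiv K L) : CombEquiv L K := by
  obtain ⟨f, hf⟩ := h
  refine ⟨f.symm, fun s => ?_⟩
  have h1 := hf (s.map f.symm.toEmbedding)
  have h2 : (s.map f.symm.toEmbedding).map f.toEmbedding = s := by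
    ext x
    simp
  rw [h2] at h1
  exact h1.symm

theorem CombEquiv.trans {U V W : Type*} {K : PreAbstractSimplicialComplex U}
    {L : PreAbstractSimplicialComplex V} {M : PreAbstractSimplicialComplex W}
    (h : CombEquiv K L) (h' : CombEquiv L M) : CombEquiv K M := by
  obtain ⟨f, hf⟩ := h
  obtain ⟨g, hg⟩ := h'
  refine ⟨f.trans g, fun s => ?_⟩
  have h2 : (s.map f.toEmbedding).map g.toEmbedding = s.map (f.trans g).toEmbedding := by
    rw [Finset.map_map]
    rfl
  rw [hf s, hg (s.map f.toEmbedding), h2]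

/-- Combinatorial equivalence as a setoid on all complexes (on vertices in any `Type`). -/
def complexSetoid : Setoid (Σ V : Type, PreAbstractSimplicialComplex V) where
  r K L := CombEquiv K.2 L.2
  iseqv := ⟨fun K => CombEquiv.refl K.2, CombEquiv.symm, CombEquiv.trans⟩

/-- Combinatorial types of simplicial complexes. -/
def CombType : Type 1 := Quotient complexSetoid

/-- The combinatorial type of a complex. -/
def combType {V : Type} (K : PreAbstractSimplicialComplex V) : CombType :=
  Quotient.mk complexSetoid ⟨V, K⟩

/-- `K` is `d`-dimensional: the largest cardinality of a face is `d + 1`. -/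
def HasDim {V : Type*} (K : PreAbstractSimplicialComplex V) (d : ℕ) : Prop :=
  IsGreatest (Finset.card '' K.faces) (d + 1)

/-! ### Links, joins, order complexes -/

/-- The link of a face `σ`: all faces `τ` with `σ ∪ τ` a face and `σ ∩ τ = ∅`. -/
def link {V : Type*} [DecidableEq V] (K : PreAbstractSimplicialComplex V) (σ : Finset V) :
    PreAbstractSimplicialComplex V where
  faces := {τ | τ ∈ K.faces ∧ σ ∪ τ ∈ K.faces ∧ Disjoint σ τ}
  isRelLowerSet_faces := by
    rintro τ ⟨h1, h2, h3⟩
    refine ⟨(K.isRelLowerSet_faces h1).1, fun ρ hρ hne => ⟨?_, ?_, ?_⟩⟩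
    · exact (K.isRelLowerSet_faces h1).2 hρ hne
    · exact (K.isRelLowerSet_faces h2).2 (Finset.union_subset_union_right hρ)
        (hne.mono Finset.subset_union_right)
    · exact h3.mono_right hρ

/-- The join of a family of complexes: its faces are the nonempty finite subsets of the disjoint
union of the vertices whose part in each complex is empty or a face. -/
def join {ι : Type*} {V : ι → Type*} (K : ∀ i, PreAbstractSimplicialComplex (V i)) :
    PreAbstractSimplicialComplex (Σ i, V i) where
  faces := {s | s.Nonempty ∧ ∀ i,
    s.preimage (Sigma.mk i) sigma_mk_injective.injOn = ∅ ∨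
      s.preimage (Sigma.mk i) sigma_mk_injective.injOn ∈ (K i).faces}
  isRelLowerSet_faces := by
    rintro s ⟨hs, h⟩
    refine ⟨hs, fun t hts hne => ⟨hne, fun i => ?_⟩⟩
    have hsub : t.preimage (Sigma.mk i) sigma_mk_injective.injOn ⊆
        s.preimage (Sigma.mk i) sigma_mk_injective.injOn := by
      intro x hx
      rw [Finset.mem_preimage] at hx ⊢
      exact hts hx
    rcases Finset.eq_empty_or_nonempty
      (t.preimage (Sigma.mk i) sigma_mk_injective.injOn) with h0 | h0
    · exact Or.inl h0
    · rcases h i with h1 | h1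
      · rw [h1, Finset.subset_empty] at hsub
        exact Or.inl hsub
      · exact Or.inr (((K i).isRelLowerSet_faces h1).2 hsub h0)

/-- The order complex of a poset: the faces are the nonempty finite chains. -/
def orderComplex (P : Type*) [PartialOrder P] : PreAbstractSimplicialComplex P where
  faces := {s | s.Nonempty ∧ IsChain (· ≤ ·) (s : Set P)}
  isRelLowerSet_faces := by
    rintro s ⟨hs, h⟩
    exact ⟨hs, fun t hts hne => ⟨hne, h.mono (Finset.coe_subset.2 hts)⟩⟩

/-- The reduced order complex of a bounded poset: the order complex of the poset without its
minimum and its maximum. -/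
def reducedOrderComplex (P : Type*) [PartialOrder P] [BoundedOrder P] :
    PreAbstractSimplicialComplex {x : P // x ≠ ⊥ ∧ x ≠ ⊤} :=
  orderComplex {x : P // x ≠ ⊥ ∧ x ≠ ⊤}

/-- The product of chains `C_{λ₁} × ⋯ × C_{λₛ}` of a partition `λ`, where `C_a` is the chain
`{0, …, a}` of length `a`; the factors are indexed by the parts, with multiplicity. -/
abbrev ChainProduct {k : ℕ} (p : k.Partition) : Type :=
  ∀ i : p.parts.ToType, Fin (i.1 + 1)

/-- The complex `K_λ`: the reduced order complex of the product of chains of `λ`. -/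
def partitionComplex {k : ℕ} (p : k.Partition) :
    PreAbstractSimplicialComplex {x : ChainProduct p // x ≠ ⊥ ∧ x ≠ ⊤} :=
  reducedOrderComplex (ChainProduct p)

/-! ### The edgewise subdivision `T_{k,q}` -/

/-- The vertex set `W_{k,q}`: integer points with `0 ≤ v₁ ≤ ⋯ ≤ v_{k-1} ≤ q`. -/
def vertices (k q : ℕ) : Set (Fin (k - 1) → ℤ) :=
  {v | Monotone v ∧ ∀ i, 0 ≤ v i ∧ v i ≤ q}

/-- The permutation `π = π₁ ⋯ π_{k-1}` is consistent with `v` if `i` is before `i + 1` in `π`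
whenever `vᵢ = vᵢ₊₁`; `π.symm i` is the position of `i` in `π`. -/
def Consistent {k : ℕ} (v : Fin (k - 1) → ℤ) (π : Equiv.Perm (Fin (k - 1))) : Prop :=
  ∀ i j : Fin (k - 1), (j : ℕ) = i + 1 → v i = v j → π.symm i < π.symm j

/-- The vertices of `F(v, π)`: the points `v`, `v + e_{π_{k-1}}`, …,
`v + e_{π_{k-1}} + ⋯ + e_{π₁} = v + 𝟙`. The point with index `a` is the one in which exactly
the coordinates at the positions `≥ a` of `π` (counted from `0`) have been increased. -/
def facet {k : ℕ} (v : Fin (k - 1) → ℤ) (π : Equiv.Perm (Fin (k - 1))) :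
    Finset (Fin (k - 1) → ℤ) :=
  (Finset.range (k - 1 + 1)).image
    fun a => fun c => v c + if a ≤ (π.symm c : ℕ) then 1 else 0

/-- The edgewise subdivision `T_{k,q}`, as an abstract complex: its facets are the `F(v, π)` with
`π` consistent with `v`, the first vertex `v` and the last vertex `v + 𝟙` being in `W_{k,q}`. -/
def edgewise (k q : ℕ) : PreAbstractSimplicialComplex (Fin (k - 1) → ℤ) where
  faces := {s | s.Nonempty ∧ ∃ (v : Fin (k - 1) → ℤ) (π : Equiv.Perm (Fin (k - 1))),
    v ∈ vertices k q ∧ v + 1 ∈ vertices k q ∧ Consistent v π ∧ s ⊆ facet v π}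
  isRelLowerSet_faces := by
    rintro s ⟨hs, v, π, h1, h2, h3, h4⟩
    exact ⟨hs, fun t hts hne => ⟨hne, v, π, h1, h2, h3, hts.trans h4⟩⟩

/-! ### The counted sets -/

/-- The combinatorial types of the links of the `d`-dimensional faces of `T_{k,q}`. -/
def linkTypes (k q d : ℕ) : Set CombType :=
  {c | ∃ σ ∈ (edgewise k q).faces, σ.card = d + 1 ∧ c = combType (link (edgewise k q) σ)}

/-- The combinatorial types of the `s`-dimensional complexes that are joins of finitely many
complexes `K_σ` for partitions `σ` with at least two parts. -/
def joinTypes (s : ℕ) : Set CombType :=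
  {c | ∃ (r : ℕ) (n : Fin r → ℕ) (σ : ∀ i, (n i).Partition),
    (∀ i, 2 ≤ (σ i).parts.card) ∧
    HasDim (join fun i => partitionComplex (σ i)) s ∧
    c = combType (join fun i => partitionComplex (σ i))}

/-- The number `Q_s`. -/
noncomputable def Q (s : ℕ) : ℕ∞ := (joinTypes s).encard

end EdgewiseSubdivision

/-
Two vertices of `T_{k,q}` span an edge exactly if they differ by a `0/1`-vector, and `T_{k,q}` is
the clique complex of this graph; order complexes are clique complexes too. So complexes are
replaced by graphs of non-edges, in which a join is a disjoint union and combinatorial type is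
isomorphism.

The vertices equal or adjacent to a fixed vertex form a product of chains without its maximum:
after homogenizing the coordinates, moving to a neighbour means increasing a set of coordinates,
and the coordinates that agree modulo `q` have to be increased in a fixed order. An `m`-face thus
is a chain with `m + 1` steps from the minimum to the maximum of such a product, and its link is
the join of the reduced order complexes of the `m + 1` intervals, which are products of chains
again.

The incomparability graph of the proper part of a product of at least two nontrivial chains is
connected and determines the chains, so the joins of the complexes `K_σ` are classified by the
multiset of their factors, where one-part partitions contribute cone points.
-/

namespace EdgewiseSubdivision

section IndepComplex

variable {V W : Type*} {G : SimpleGraph V} {H : SimpleGraph W} {A : Set V} {B : Set W}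

/-- The complex of the nonempty finite independent sets of a graph that are contained in a given
set of vertices. Complexes of this form are flag complexes; the edges of the graph are the
minimal non-faces. -/
def indepComplex (G : SimpleGraph V) (A : Set V) : PreAbstractSimplicialComplex V where
  faces := {s | s.Nonempty ∧ (s : Set V) ⊆ A ∧ G.IsIndepSet s}
  isRelLowerSet_faces := by
    rintro s ⟨hs, hA, h⟩
    exact ⟨hs, fun t hts hne => ⟨hne, (Finset.coe_subset.2 hts).trans hA,
      h.mono (Finset.coe_subset.2 hts)⟩⟩

theorem mem_faces_indepComplex {s : Finset V} : s ∈ (indepComplex G A).faces ↔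
    s.Nonempty ∧ (s : Set V) ⊆ A ∧ G.IsIndepSet s := Iff.rfl

theorem vertexSet_indepComplex (G : SimpleGraph V) (A : Set V) :
    vertexSet (indepComplex G A) = A := by
  ext v
  simp [vertexSet, mem_faces_indepComplex, SimpleGraph.IsIndepSet]

theorem map_subtype_mem_faces_indepComplex {s : Finset (vertexSet (indepComplex G A))} :
    s.map (Function.Embedding.subtype _) ∈ (indepComplex G A).faces ↔
      s.Nonempty ∧ ∀ x ∈ s, ∀ y ∈ s, ¬ G.Adj x y := by
  rw [mem_faces_indepComplex, Finset.map_nonempty]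
  refine and_congr_right fun _ => ⟨?_, fun h => ⟨?_, ?_⟩⟩
  · rintro ⟨-, h⟩ x hx y hy hxy
    exact h (by simp [hx]) (by simp [hy]) hxy.ne hxy
  · rintro v hv
    obtain ⟨x, -, rfl⟩ := Finset.mem_map.1 (Finset.mem_coe.1 hv)
    exact (vertexSet_indepComplex G A).subset x.2
  · rintro v hv w hw -
    obtain ⟨x, hx, rfl⟩ := Finset.mem_map.1 (Finset.mem_coe.1 hv)
    obtain ⟨y, hy, rfl⟩ := Finset.mem_map.1 (Finset.mem_coe.1 hw)
    exact h x hx y hy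

theorem adj_iff_pair_notMem_faces [DecidableEq (vertexSet (indepComplex G A))]
    (x y : vertexSet (indepComplex G A)) : G.Adj x y ↔
      ({x, y} : Finset _).map (Function.Embedding.subtype _) ∉ (indepComplex G A).faces := by
  rw [map_subtype_mem_faces_indepComplex]
  simp [G.adj_comm y x]

theorem combEquiv_indepComplex_iff :
    CombEquiv (indepComplex G A) (indepComplex H B) ↔
      Nonempty (G.induce A ≃g H.induce B) := by
  classical
  suffices h : CombEquiv (indepComplex G A) (indepComplex H B) ↔
      Nonempty (G.induce (vertexSet (indepComplex G A)) ≃g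
        H.induce (vertexSet (indepComplex H B))) by
    rwa [vertexSet_indepComplex, vertexSet_indepComplex] at h
  constructor
  · rintro ⟨f, hf⟩
    refine ⟨⟨f, fun {x y} => ?_⟩⟩
    rw [SimpleGraph.comap_adj, SimpleGraph.comap_adj]
    simp only [Function.Embedding.subtype_apply]
    rw [adj_iff_pair_notMem_faces, adj_iff_pair_notMem_faces, hf]
    simp
  · rintro ⟨f⟩
    refine ⟨f.toEquiv, fun s => ?_⟩
    rw [map_subtype_mem_faces_indepComplex, map_subtype_mem_faces_indepComplex,
      Finset.map_nonempty]
    simp only [Finset.forall_mem_map]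
    refine and_congr_right fun _ => forall₂_congr fun x _ => forall₂_congr fun y _ => ?_
    exact not_congr f.map_adj_iff.symm

theorem combType_indepComplex_eq_iff {V W : Type} {G : SimpleGraph V} {H : SimpleGraph W}
    {A : Set V} {B : Set W} : combType (indepComplex G A) = combType (indepComplex H B) ↔
      Nonempty (G.induce A ≃g H.induce B) :=
  (Quotient.eq (r := complexSetoid)).trans combEquiv_indepComplex_iff

theorem combType_indepComplex_univ_eq_iff {V W : Type} {G : SimpleGraph V} {H : SimpleGraph W} :
    combType (indepComplex G Set.univ) = combType (indepComplex H Set.univ) ↔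
      Nonempty (G ≃g H) :=
  combType_indepComplex_eq_iff.trans
    ⟨fun ⟨e⟩ => ⟨(G.induceUnivIso.symm.trans e).trans H.induceUnivIso⟩,
      fun ⟨e⟩ => ⟨(G.induceUnivIso.trans e).trans H.induceUnivIso.symm⟩⟩

theorem link_indepComplex [DecidableEq V] {σ : Finset V} (hσ : σ ∈ (indepComplex G A).faces) :
    link (indepComplex G A) σ = indepComplex G {v ∈ A | v ∉ σ ∧ ∀ w ∈ σ, ¬ G.Adj w v} := by
  ext τ
  change (τ ∈ (indepComplex G A).faces ∧ σ ∪ τ ∈ (indepComplex G A).faces ∧ Disjoint σ τ) ↔ _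
  simp only [mem_faces_indepComplex, Finset.coe_union, Set.union_subset_iff]
  constructor
  · rintro ⟨⟨hne, hτA, hτ⟩, ⟨-, -, hστ⟩, hdisj⟩
    refine ⟨hne, fun v hv => ⟨hτA hv, fun hvσ => Finset.disjoint_left.1 hdisj hvσ hv, ?_⟩, hτ⟩
    exact fun w hw hwv => hστ (Or.inl hw) (Or.inr hv) hwv.ne hwv
  · rintro ⟨hne, hτA, hτ⟩
    refine ⟨⟨hne, fun v hv => (hτA hv).1, hτ⟩, ⟨hne.inr, ⟨hσ.2.1, fun v hv => (hτA hv).1⟩, ?_⟩,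
      Finset.disjoint_left.2 fun v hvσ hvτ => (hτA hvτ).2.1 hvσ⟩
    rintro v (hv | hv) w (hw | hw) hvw
    · exact hσ.2.2 hv hw hvw
    · exact (hτA hw).2.2 v hv
    · exact fun h => (hτA hv).2.2 w hw h.symm
    · exact hτ hv hw hvw

end IndepComplex

section IncompGraph

/-- The incomparability graph of a partial order. -/
def incompGraph (P : Type*) [PartialOrder P] : SimpleGraph P where
  Adj := IncompRel (· ≤ ·)
  symm := ⟨fun _ _ h => h.symm⟩
  loopless := ⟨fun _ h => h.1 le_rfl⟩

variable {P : Type*} [PartialOrder P]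

theorem incompGraph_adj {a b : P} : (incompGraph P).Adj a b ↔ ¬ a ≤ b ∧ ¬ b ≤ a := Iff.rfl

theorem not_incompGraph_adj {a b : P} : ¬ (incompGraph P).Adj a b ↔ a ≤ b ∨ b ≤ a := by
  rw [incompGraph_adj]
  tauto

theorem orderComplex_eq_indepComplex (P : Type*) [PartialOrder P] :
    orderComplex P = indepComplex (incompGraph P) Set.univ := by
  ext s
  change (s.Nonempty ∧ IsChain (· ≤ ·) (s : Set P)) ↔ _
  rw [mem_faces_indepComplex]
  simp only [Set.subset_univ, true_and]
  refine and_congr_right fun _ => ?_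
  simp only [IsChain, SimpleGraph.IsIndepSet, Set.Pairwise, not_incompGraph_adj]

end IncompGraph

section SigmaGraph

variable {J J' : Type*} {V : J → Type*} {V' : J' → Type*} {G' : ∀ j, SimpleGraph (V' j)}
  {G : ∀ j, SimpleGraph (V j)}

/-- The disjoint union of a family of graphs. -/
def sigmaGraph (G : ∀ j, SimpleGraph (V j)) : SimpleGraph (Σ j, V j) :=
  ⨆ j, (G j).map (Function.Embedding.sigmaMk j)

theorem sigmaGraph_adj {u v : Σ j, V j} : (sigmaGraph G).Adj u v ↔
    ∃ j a b, (G j).Adj a b ∧ ⟨j, a⟩ = u ∧ ⟨j, b⟩ = v := by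
  simp [sigmaGraph, SimpleGraph.map_adj]

theorem sigmaGraph_adj_mk {j : J} {a b : V j} :
    (sigmaGraph G).Adj ⟨j, a⟩ ⟨j, b⟩ ↔ (G j).Adj a b := by
  refine sigmaGraph_adj.trans ⟨?_, fun h => ⟨j, a, b, h, rfl, rfl⟩⟩
  rintro ⟨i, a', b', h, ha, hb⟩
  obtain ⟨rfl, ha⟩ := Sigma.mk.inj_iff.1 ha
  rwa [← eq_of_heq ha, ← eq_of_heq (Sigma.mk.inj_iff.1 hb).2]

theorem fst_eq_of_sigmaGraph_adj {u v : Σ j, V j} (h : (sigmaGraph G).Adj u v) : u.1 = v.1 := by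
  obtain ⟨j, a, b, -, rfl, rfl⟩ := sigmaGraph_adj.1 h
  rfl

theorem join_indepComplex (G : ∀ j, SimpleGraph (V j)) :
    (join fun j => indepComplex (G j) Set.univ) = indepComplex (sigmaGraph G) Set.univ := by
  ext s
  refine and_congr_right fun _ => ?_
  simp only [mem_faces_indepComplex, Set.subset_univ, true_and]
  constructor
  · rintro h u hu v hv - huv
    obtain ⟨j, a, b, hab, rfl, rfl⟩ := sigmaGraph_adj.1 huv
    have ha := (Finset.mem_preimage (hf := sigma_mk_injective.injOn)).2 hu
    have hb := (Finset.mem_preimage (hf := sigma_mk_injective.injOn)).2 hv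
    rcases h j with h | ⟨-, h⟩
    · simp [h] at ha
    · exact h ha hb hab.ne hab
  · intro h j
    refine (Finset.eq_empty_or_nonempty _).imp_right fun h0 => ⟨h0, fun a ha b hb _ hab => ?_⟩
    have huv := sigmaGraph_adj_mk.2 hab
    exact h (Finset.mem_preimage.1 ha) (Finset.mem_preimage.1 hb) huv.ne huv

/-- Disjoint unions of isomorphic graphs are isomorphic. -/
def sigmaGraphCongr (e : J ≃ J') (f : ∀ j, G j ≃g G' (e j)) : sigmaGraph G ≃g sigmaGraph G' where
  toEquiv := Equiv.sigmaCongr e fun j => (f j).toEquiv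
  map_rel_iff' := by
    rintro ⟨i, a⟩ ⟨j, b⟩
    rcases eq_or_ne i j with rfl | hij
    · exact sigmaGraph_adj_mk.trans ((f i).map_adj_iff.trans sigmaGraph_adj_mk.symm)
    · refine iff_of_false (fun h => hij (e.injective ?_)) fun h => hij ?_
      exacts [fst_eq_of_sigmaGraph_adj h, fst_eq_of_sigmaGraph_adj h]

/-- A disjoint union of disjoint unions is a disjoint union. -/
def sigmaGraphAssoc {I : J → Type*} {U : ∀ j, I j → Type*} (H : ∀ j i, SimpleGraph (U j i)) :
    (sigmaGraph fun x : Σ j, I j => H x.1 x.2) ≃g sigmaGraph fun j => sigmaGraph (H j) where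
  toEquiv := Equiv.sigmaAssoc U
  map_rel_iff' := by
    rintro ⟨⟨j, i⟩, a⟩ ⟨⟨j', i'⟩, a'⟩
    rcases eq_or_ne (⟨j, i⟩ : Σ j, I j) ⟨j', i'⟩ with h | h
    · cases h
      exact (sigmaGraph_adj_mk (G := fun j => sigmaGraph (H j))).trans
        (sigmaGraph_adj_mk.trans
          (sigmaGraph_adj_mk (G := fun x : Σ j, I j => H x.1 x.2) (j := ⟨j, i⟩)).symm)
    · refine iff_of_false (fun hadj => h ?_) fun hadj => h (fst_eq_of_sigmaGraph_adj hadj)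
      obtain rfl : j = j' := fst_eq_of_sigmaGraph_adj hadj
      obtain rfl : i = i' :=
        fst_eq_of_sigmaGraph_adj ((sigmaGraph_adj_mk (G := fun j => sigmaGraph (H j))).1 hadj)
      rfl

/-- The disjoint union of a single graph. -/
def sigmaGraphUnique [Unique J] (G : ∀ j, SimpleGraph (V j)) :
    sigmaGraph G ≃g G default where
  toEquiv := Equiv.uniqueSigma V
  map_rel_iff' := by
    rintro ⟨i, a⟩ ⟨j, b⟩
    obtain rfl := Unique.eq_default i
    obtain rfl := Unique.eq_default j
    exact sigmaGraph_adj_mk.symm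

/-- An edgeless graph is a disjoint union of points. -/
def botIsoSigmaGraph (V : Type*) :
    (⊥ : SimpleGraph V) ≃g sigmaGraph fun _ : V => (⊥ : SimpleGraph Unit) where
  toEquiv := (Equiv.sigmaUnique V fun _ => Unit).symm
  map_rel_iff' := by
    simp [sigmaGraph_adj]

/-- The member with index `j` of a disjoint union. -/
def sigmaFiberIso (G : ∀ j, SimpleGraph (V j)) (j : J) :
    (sigmaGraph G).induce {u | u.1 = j} ≃g G j where
  toEquiv := Equiv.sigmaSubtype j
  map_rel_iff' := by
    rintro ⟨⟨i, a⟩, rfl⟩ ⟨⟨i', b⟩, hb : i' = i⟩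
    subst hb
    exact sigmaGraph_adj_mk.symm

theorem fst_eq_of_reachable {u v : Σ j, V j} (h : (sigmaGraph G).Reachable u v) : u.1 = v.1 := by
  obtain ⟨p⟩ := h
  induction p with
  | nil => rfl
  | cons h _ ih => exact (fst_eq_of_sigmaGraph_adj h).trans ih

theorem reachable_sigmaGraph_iff (hG : ∀ j, (G j).Preconnected) {u v : Σ j, V j} :
    (sigmaGraph G).Reachable u v ↔ u.1 = v.1 := by
  refine ⟨fst_eq_of_reachable, ?_⟩
  obtain ⟨j, a⟩ := u
  obtain ⟨i, b⟩ := v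
  rintro rfl
  exact (hG j a b).map ⟨Sigma.mk j, sigmaGraph_adj_mk.2⟩

theorem exists_iso_of_sigmaGraph_iso (hG : ∀ j, (G j).Connected) (hG' : ∀ j, (G' j).Connected)
    (φ : sigmaGraph G ≃g sigmaGraph G') :
    ∃ e : J ≃ J', ∀ j, Nonempty (G j ≃g G' (e j)) := by
  have hφ : ∀ u v, (φ u).1 = (φ v).1 ↔ u.1 = v.1 := fun u v => by
    rw [← reachable_sigmaGraph_iff fun j => (hG' j).preconnected, φ.reachable_iff,
      reachable_sigmaGraph_iff fun j => (hG j).preconnected]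
  let pt : ∀ j, V j := fun j => (hG j).nonempty.some
  have he : Function.Bijective fun j => (φ ⟨j, pt j⟩).1 := by
    refine ⟨fun i j hij => (hφ ⟨i, pt i⟩ ⟨j, pt j⟩).1 hij, fun i => ?_⟩
    have b := (hG' i).nonempty.some
    refine ⟨(φ.symm ⟨i, b⟩).1, ((hφ ⟨_, pt _⟩ (φ.symm ⟨i, b⟩)).2 rfl).trans ?_⟩
    rw [φ.apply_symm_apply]
  refine ⟨Equiv.ofBijective _ he, fun j => ⟨?_⟩⟩
  have hfiber : ∀ u, u.1 = j ↔ (φ u).1 = (φ ⟨j, pt j⟩).1 := fun u => (hφ u ⟨j, pt j⟩).symm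
  let φj : (sigmaGraph G).induce {u | u.1 = j} ≃g
      (sigmaGraph G').induce {u | u.1 = (φ ⟨j, pt j⟩).1} :=
    ⟨φ.toEquiv.subtypeEquiv hfiber, φ.map_adj_iff⟩
  exact ((sigmaFiberIso G j).symm.trans φj).trans (sigmaFiberIso G' _)

end SigmaGraph

section Multichains

theorem monotone_eq_of_map_univ_eq {P : Type*} [PartialOrder P] {t : ℕ} {f g : Fin t → P}
    (hf : Monotone f) (hg : Monotone g) (h : Finset.univ.val.map f = Finset.univ.val.map g) :
    f = g := by
  refine List.ofFn_injective (List.Perm.eq_of_pairwise (le := (· ≤ ·)) ?_ ?_ ?_ ?_)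
  · exact fun a b _ _ hab hba => le_antisymm hab hba
  · exact List.pairwise_ofFn.2 fun i j hij => hf hij.le
  · exact List.pairwise_ofFn.2 fun i j hij => hg hij.le
  · rw [← Multiset.coe_eq_coe]
    simpa [List.ofFn_eq_map] using h

theorem exists_monotone_map_univ_eq {P : Type*} [PartialOrder P] {t : ℕ} {m : Multiset P}
    (hm : m.card = t) (h : ∀ a ∈ m, ∀ b ∈ m, ¬ (incompGraph P).Adj a b) :
    ∃ f : Fin t → P, Monotone f ∧ Finset.univ.val.map f = m := by
  classical
  subst hm
  obtain ⟨r, hr, hle⟩ := extend_partialOrder ((· ≤ ·) : P → P → Prop)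
  have hsorted : (m.sort r).Pairwise (· ≤ ·) := by
    refine (Multiset.pairwise_sort m r).imp_of_mem fun {a b} ha hb hab => ?_
    rcases not_incompGraph_adj.1 (h a ((Multiset.mem_sort r).1 ha) b ((Multiset.mem_sort r).1 hb))
      with h1 | h1
    · exact h1
    · exact (antisymm (r := r) hab (hle _ _ h1)).le
  have hlen : (m.sort r).length = m.card := Multiset.length_sort r
  refine ⟨fun i => (m.sort r).get (i.cast hlen.symm), fun i j hij => ?_, ?_⟩
  · rcases hij.eq_or_lt with rfl | hij
    · exact le_rfl
    · exact List.pairwise_iff_get.1 hsorted _ _ hij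
  · conv_rhs => rw [← Multiset.sort_eq m r]
    rw [Fin.univ_val_map, List.ofFn_congr hlen.symm]
    exact congrArg _ (List.ofFn_get _)

/-- The number of multichains with `t` elements; as a function of `t` it is the zeta polynomial
of the poset (with argument shifted by one). -/
noncomputable def multichainCount (P : Type*) [PartialOrder P] (t : ℕ) : ℕ :=
  Nat.card {f : Fin t → P // Monotone f}

theorem multichainCount_eq_card_sym (P : Type*) [PartialOrder P] (t : ℕ) :
    multichainCount P t =
      Nat.card {m : Sym P t // ∀ a ∈ m, ∀ b ∈ m, ¬ (incompGraph P).Adj a b} := by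
  refine Nat.card_congr (Equiv.ofBijective
    (fun f => ⟨⟨Finset.univ.val.map f.1, by simp⟩, ?_⟩) ⟨?_, ?_⟩)
  · intro a ha b hb
    obtain ⟨i, -, rfl⟩ := Multiset.mem_map.1 ((Sym.mem_mk _ _ _).1 ha)
    obtain ⟨j, -, rfl⟩ := Multiset.mem_map.1 ((Sym.mem_mk _ _ _).1 hb)
    exact not_incompGraph_adj.2 ((le_total i j).imp (fun h => f.2 h) fun h => f.2 h)
  · intro f g h
    have hmap : Finset.univ.val.map f.1 = Finset.univ.val.map g.1 :=
      congrArg (fun m => (m.1 : Multiset P)) h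
    exact Subtype.ext (monotone_eq_of_map_univ_eq f.2 g.2 hmap)
  · rintro ⟨⟨m, hm⟩, h⟩
    obtain ⟨f, hf, hfm⟩ := exists_monotone_map_univ_eq hm h
    exact ⟨⟨f, hf⟩, Subtype.ext (Subtype.ext hfm)⟩

theorem multichainCount_congr {P R : Type*} [PartialOrder P] [PartialOrder R]
    (e : incompGraph P ≃g incompGraph R) (t : ℕ) : multichainCount P t = multichainCount R t := by
  rw [multichainCount_eq_card_sym, multichainCount_eq_card_sym]
  refine Nat.card_congr ((Sym.equivCongr e.toEquiv).subtypeEquiv fun m => ?_)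
  simp only [Sym.equivCongr, Equiv.coe_fn_mk, Sym.mem_map, forall_exists_index, and_imp,
    forall_apply_eq_imp_iff₂]
  exact forall₂_congr fun a _ => forall₂_congr fun b _ => not_congr e.map_adj_iff.symm

theorem multichainCount_of_linearOrder (P : Type*) [LinearOrder P] [Fintype P] (t : ℕ) :
    multichainCount P t = (Fintype.card P).multichoose t := by
  classical
  rw [multichainCount_eq_card_sym, ← Sym.card_sym_eq_multichoose, ← Nat.card_eq_fintype_card]
  exact Nat.card_congr (Equiv.subtypeUnivEquiv fun m a _ b _ =>
    not_incompGraph_adj.2 (le_total a b))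

theorem multichainCount_pi {ι : Type*} [Fintype ι] (P : ι → Type*) [∀ i, PartialOrder (P i)]
    (t : ℕ) : multichainCount (∀ i, P i) t = ∏ i, multichainCount (P i) t := by
  unfold multichainCount
  rw [← Nat.card_pi]
  exact Nat.card_congr ⟨fun f i => ⟨fun a => f.1 a i, fun a b h => f.2 h i⟩,
    fun f => ⟨fun a i => (f i).1 a, fun a b h i => (f i).2 h⟩, fun f => rfl, fun f => rfl⟩

/-- The product of chains whose lengths are the elements of a multiset. -/
abbrev Chains (σ : Multiset ℕ) : Type := ∀ i : σ.ToType, Fin (i.1 + 1)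

theorem multichainCount_chains (σ : Multiset ℕ) (t : ℕ) :
    multichainCount (Chains σ) t = (σ.map fun a => (a + 1).multichoose t).prod := by
  simp only [multichainCount_pi, multichainCount_of_linearOrder, Fintype.card_fin]
  conv_rhs => rw [← Multiset.map_univ_coe σ, Multiset.map_map]
  rfl

end Multichains

section Multichoose

theorem multichoose_add_one_mul (a t : ℕ) :
    (a + 1).multichoose (t + 1) * (t + 1) = (a + 1).multichoose t * (a + (t + 1)) := by
  rw [Nat.multichoose_eq, Nat.multichoose_eq,
    show a + 1 + (t + 1) - 1 = (a + t) + 1 by omega, show a + 1 + t - 1 = a + t by omega,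
    ← Nat.add_one_mul_choose_eq]
  ring

theorem prod_multichoose_mul_pow (s : Multiset ℕ) (t : ℕ) :
    (s.map fun a => (a + 1).multichoose (t + 1)).prod * (t + 1) ^ s.card =
      (s.map fun a => (a + 1).multichoose t).prod * (s.map fun a => a + (t + 1)).prod := by
  induction s using Multiset.induction with
  | empty => simp
  | cons a s ih =>
    simp only [Multiset.map_cons, Multiset.prod_cons, Multiset.card_cons, pow_succ]
    calc _ = (a + 1).multichoose (t + 1) * (t + 1) *
          ((s.map fun a => (a + 1).multichoose (t + 1)).prod * (t + 1) ^ s.card) := by ring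
      _ = _ := by rw [ih, multichoose_add_one_mul]; ring

theorem prod_multichoose_pos (s : Multiset ℕ) (t : ℕ) :
    0 < (s.map fun a => (a + 1).multichoose t).prod := by
  refine Multiset.prod_pos fun x hx => ?_
  obtain ⟨a, -, rfl⟩ := Multiset.mem_map.1 hx
  rw [Nat.multichoose_eq]
  exact Nat.choose_pos (by omega)

open Polynomial in
theorem eq_of_prod_X_add_C_mul_X_pow_eq {s s' : Multiset ℕ} (hs : 0 ∉ s) (hs' : 0 ∉ s') {k k' : ℕ}
    (h : (s.map fun a : ℕ => (X + C (a : ℤ))).prod * X ^ k =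
      (s'.map fun a : ℕ => (X + C (a : ℤ))).prod * X ^ k') : s = s' := by
  have hroots : ∀ (s : Multiset ℕ) (k : ℕ),
      ((s.map fun a : ℕ => (X + C (a : ℤ))).prod * X ^ k).roots =
        s.map (fun a : ℕ => -(a : ℤ)) + Multiset.replicate k 0 := by
    intro s k
    rw [← roots_multiset_prod_X_sub_C (s.map (fun a : ℕ => -(a : ℤ)) + Multiset.replicate k 0)]
    simp [Multiset.map_map]
  have hnonzero : ∀ s : Multiset ℕ, 0 ∉ s → ∀ k, (s.map (fun a : ℕ => -(a : ℤ)) +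
      Multiset.replicate k 0).filter (· ≠ 0) = s.map fun a : ℕ => -(a : ℤ) := by
    intro s hs k
    rw [Multiset.filter_add, Multiset.filter_eq_self.2, Multiset.filter_eq_nil.2, add_zero]
    · exact fun a ha => not_not.2 (Multiset.eq_of_mem_replicate ha)
    · intro b hb
      obtain ⟨a, ha, rfl⟩ := Multiset.mem_map.1 hb
      simpa using ne_of_mem_of_not_mem ha hs
  refine Multiset.map_injective (f := fun a : ℕ => -(a : ℤ)) (fun a b hab => by simpa using hab) ?_
  rw [← hnonzero s hs k, ← hnonzero s' hs' k', ← hroots, ← hroots, h]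

open Polynomial in
theorem eq_of_prod_multichoose_eq {s s' : Multiset ℕ} (hs : 0 ∉ s) (hs' : 0 ∉ s')
    (h : ∀ t, (s.map fun a => (a + 1).multichoose t).prod =
      (s'.map fun a => (a + 1).multichoose t).prod) : s = s' := by
  have hratio : ∀ t : ℕ, (s.map fun a => a + (t + 1)).prod * (t + 1) ^ s'.card =
      (s'.map fun a => a + (t + 1)).prod * (t + 1) ^ s.card := by
    intro t
    have hs1 := prod_multichoose_mul_pow s t
    have hs2 := prod_multichoose_mul_pow s' t
    rw [h (t + 1), h t] at hs1
    refine Nat.eq_of_mul_eq_mul_left (prod_multichoose_pos s' t) ?_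
    rw [← mul_assoc, ← hs1, ← mul_assoc, ← hs2]
    ring
  have heval : ∀ (s : Multiset ℕ) (k t : ℕ),
      ((s.map fun a : ℕ => (X + C (a : ℤ))).prod * X ^ k).eval (t + 1 : ℤ) =
        (((s.map fun a => a + (t + 1)).prod * (t + 1) ^ k : ℕ) : ℤ) := by
    intro s k t
    simp [eval_multiset_prod, Multiset.map_map, add_comm]
  refine eq_of_prod_X_add_C_mul_X_pow_eq (k := s'.card) (k' := s.card) hs hs'
    (eq_of_infinite_eval_eq _ _ ((Set.infinite_range_of_injective (f := fun t : ℕ => (t : ℤ) + 1)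
      fun a b hab => by simpa using hab).mono ?_))
  rintro _ ⟨t, rfl⟩
  exact (heval s s'.card t).trans ((congrArg _ (hratio t)).trans (heval s' s.card t).symm)

end Multichoose

section ProperPart

/-- The proper part of a bounded poset: the poset without its minimum and its maximum. -/
abbrev ProperPart (P : Type*) [PartialOrder P] [BoundedOrder P] : Type _ :=
  {x : P // x ≠ ⊥ ∧ x ≠ ⊤}

theorem nonempty_iso_of_induce_iso {V W : Type*} {G : SimpleGraph V} {H : SimpleGraph W}
    {A : Set V} {B : Set W} (hA : ∀ v ∉ A, ∀ w, ¬ G.Adj v w) (hB : ∀ v ∉ B, ∀ w, ¬ H.Adj v w)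
    (e : G.induce A ≃g H.induce B) (f : ↥Aᶜ ≃ ↥Bᶜ) : Nonempty (G ≃g H) := by
  classical
  refine ⟨⟨(Equiv.Set.sumCompl A).symm.trans
    ((Equiv.sumCongr e.toEquiv f).trans (Equiv.Set.sumCompl B)), fun {v w} => ?_⟩⟩
  obtain ⟨v, rfl⟩ := (Equiv.Set.sumCompl A).surjective v
  obtain ⟨w, rfl⟩ := (Equiv.Set.sumCompl A).surjective w
  simp only [Equiv.trans_apply, Equiv.symm_apply_apply]
  rcases v with v | v
  · rcases w with w | w
    · exact e.map_adj_iff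
    · exact iff_of_false (fun h => hB _ (f w).2 _ h.symm) fun h => hA _ w.2 _ h.symm
  · exact iff_of_false (hB _ (f v).2 _) (hA _ v.2 _)

variable {P R : Type*} [PartialOrder P] [BoundedOrder P] [PartialOrder R] [BoundedOrder R]

theorem not_incompGraph_adj_of_notMem_properPart {x : P} (hx : x ∉ {x : P | x ≠ ⊥ ∧ x ≠ ⊤})
    (y : P) : ¬ (incompGraph P).Adj x y := by
  rw [not_incompGraph_adj]
  obtain rfl | rfl : x = ⊥ ∨ x = ⊤ := by simpa [or_iff_not_imp_left] using hx
  exacts [Or.inl bot_le, Or.inr le_top]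

theorem compl_properPart : {x : P | x ≠ ⊥ ∧ x ≠ ⊤}ᶜ = {⊥, ⊤} := by
  ext x
  simp [or_iff_not_imp_left]

theorem nonempty_incompGraph_iso_of_properPart [Nontrivial P] [Nontrivial R]
    (e : incompGraph (ProperPart P) ≃g incompGraph (ProperPart R)) :
    Nonempty (incompGraph P ≃g incompGraph R) := by
  have hcard : Nat.card ↥{x : P | x ≠ ⊥ ∧ x ≠ ⊤}ᶜ = Nat.card ↥{x : R | x ≠ ⊥ ∧ x ≠ ⊤}ᶜ := by
    rw [compl_properPart, compl_properPart]
    exact (Set.ncard_pair bot_ne_top).trans (Set.ncard_pair bot_ne_top).symm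
  have : Finite ↥{x : P | x ≠ ⊥ ∧ x ≠ ⊤}ᶜ := by
    rw [compl_properPart]
    infer_instance
  have : Finite ↥{x : R | x ≠ ⊥ ∧ x ≠ ⊤}ᶜ := by
    rw [compl_properPart]
    infer_instance
  exact nonempty_iso_of_induce_iso (fun _ => not_incompGraph_adj_of_notMem_properPart)
    (fun _ => not_incompGraph_adj_of_notMem_properPart) e (Finite.card_eq.1 hcard).some

theorem card_properPart_add_two (P : Type*) [PartialOrder P] [BoundedOrder P] [Nontrivial P]
    [Finite P] : Nat.card (ProperPart P) + 2 = Nat.card P := by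
  rw [← Set.ncard_pair (bot_ne_top (α := P)), ← compl_properPart]
  exact Set.ncard_add_ncard_compl {x : P | x ≠ ⊥ ∧ x ≠ ⊤}

end ProperPart

section Connected

variable {ι : Type*} [DecidableEq ι] {P : ι → Type*} [∀ i, PartialOrder (P i)]
  [∀ i, BoundedOrder (P i)]

/-- The element of a product of bounded posets that is maximal in one coordinate and minimal in
the others. -/
def column (P : ι → Type*) [∀ i, PartialOrder (P i)] [∀ i, BoundedOrder (P i)] (j : ι) :
    ∀ i, P i :=
  Function.update ⊥ j ⊤

theorem column_self (j : ι) : column P j j = ⊤ := Function.update_self ..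

theorem column_of_ne {i j : ι} (h : i ≠ j) : column P j i = ⊥ := Function.update_of_ne h ..

theorem incompGraph_adj_column {x : ∀ i, P i} {i j : ι} (hij : i ≠ j) (hi : x i ≠ ⊥)
    (hj : x j ≠ ⊤) : (incompGraph (∀ i, P i)).Adj x (column P j) :=
  ⟨fun h => hi (le_bot_iff.1 ((h i).trans_eq (column_of_ne hij))),
    fun h => hj (top_le_iff.1 ((column_self j).symm.trans_le (h j)))⟩

variable [Nontrivial ι] [∀ i, Nontrivial (P i)]

theorem column_ne_bot_and_ne_top (j : ι) : column P j ≠ ⊥ ∧ column P j ≠ ⊤ := by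
  obtain ⟨i, hi⟩ := exists_ne j
  constructor <;> intro h
  · exact bot_ne_top ((congrFun h j).symm.trans (column_self j))
  · exact bot_ne_top ((column_of_ne hi).symm.trans (congrFun h i))

theorem exists_incompGraph_adj_column {x : ∀ i, P i} (h : x ≠ ⊥ ∧ x ≠ ⊤) :
    ∃ j, (incompGraph (∀ i, P i)).Adj x (column P j) := by
  by_cases hbot : ∃ j, x j = ⊥
  · obtain ⟨j, hj⟩ := hbot
    obtain ⟨i, hi⟩ := Function.ne_iff.1 h.1
    have hij : i ≠ j := by
      rintro rfl
      exact hi hj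
    exact ⟨j, incompGraph_adj_column hij hi (hj.trans_ne bot_ne_top)⟩
  · push Not at hbot
    obtain ⟨j, hj⟩ := Function.ne_iff.1 h.2
    obtain ⟨i, hi⟩ := exists_ne j
    exact ⟨j, incompGraph_adj_column hi (hbot i) hj⟩

omit [DecidableEq ι] in
theorem connected_incompGraph_properPart_pi :
    (incompGraph (ProperPart (∀ i, P i))).Connected := by
  classical
  have hcolumns : ∀ i j, (incompGraph (ProperPart (∀ i, P i))).Reachable
      ⟨column P i, column_ne_bot_and_ne_top i⟩ ⟨column P j, column_ne_bot_and_ne_top j⟩ := by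
    intro i j
    rcases eq_or_ne i j with rfl | hij
    · rfl
    · exact SimpleGraph.Adj.reachable (incompGraph_adj_column hij
        ((column_self i).trans_ne top_ne_bot) ((column_of_ne hij.symm).trans_ne bot_ne_top))
  have : Nonempty (ProperPart (∀ i, P i)) :=
    ⟨⟨_, column_ne_bot_and_ne_top (exists_pair_ne ι).choose⟩⟩
  refine ⟨fun x y => ?_⟩
  obtain ⟨i, hi⟩ := exists_incompGraph_adj_column x.2
  obtain ⟨j, hj⟩ := exists_incompGraph_adj_column y.2
  have hxi : (incompGraph (ProperPart (∀ i, P i))).Adj x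
    ⟨column P i, column_ne_bot_and_ne_top i⟩ := hi
  have hyj : (incompGraph (ProperPart (∀ i, P i))).Adj y
    ⟨column P j, column_ne_bot_and_ne_top j⟩ := hj
  exact (hxi.reachable.trans (hcolumns i j)).trans hyj.reachable.symm

end Connected

section Chains

/-- The graph whose independence complex is `K_σ`. -/
abbrev partitionGraph (σ : Multiset ℕ) : SimpleGraph (ProperPart (Chains σ)) :=
  incompGraph (ProperPart (Chains σ))

variable {σ τ : Multiset ℕ}

theorem nontrivial_chain_of_notMem (hσ : 0 ∉ σ) (i : σ.ToType) : Nontrivial (Fin (i.1 + 1)) := by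
  have : i.1 ≠ 0 := ne_of_mem_of_not_mem Multiset.coe_mem hσ
  exact Fin.nontrivial_iff_two_le.2 (by omega)

theorem nontrivial_chains (hσ : 0 ∉ σ) (h0 : σ ≠ 0) : Nontrivial (Chains σ) := by
  obtain ⟨a, ha⟩ := Multiset.exists_mem_of_ne_zero h0
  let i : σ.ToType := ⟨a, ⟨0, Multiset.count_pos.2 ha⟩⟩
  have := nontrivial_chain_of_notMem hσ i
  exact Pi.nontrivial_at i

theorem eq_of_partitionGraph_iso (hσ : 0 ∉ σ) (hτ : 0 ∉ τ) (hσ0 : σ ≠ 0) (hτ0 : τ ≠ 0)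
    (e : partitionGraph σ ≃g partitionGraph τ) : σ = τ := by
  have := nontrivial_chains hσ hσ0
  have := nontrivial_chains hτ hτ0
  obtain ⟨g⟩ := nonempty_incompGraph_iso_of_properPart e
  refine eq_of_prod_multichoose_eq hσ hτ fun t => ?_
  rw [← multichainCount_chains, ← multichainCount_chains, multichainCount_congr g]

theorem connected_partitionGraph (hσ : 0 ∉ σ) (h : 2 ≤ σ.card) :
    (partitionGraph σ).Connected := by
  have : Nontrivial σ.ToType := by
    rwa [← Fintype.one_lt_card_iff_nontrivial, Multiset.card_coe]
  have := nontrivial_chain_of_notMem hσ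
  exact connected_incompGraph_properPart_pi

theorem partitionGraph_eq_bot (h : σ.card < 2) :
    partitionGraph σ = ⊥ := by
  have : Subsingleton σ.ToType := by
    rw [← Fintype.card_le_one_iff_subsingleton, Multiset.card_coe]
    omega
  ext x y
  refine iff_of_false (not_incompGraph_adj.2 ?_) id
  by_cases h : ∃ i, x.1 i ≤ y.1 i
  · obtain ⟨i, hi⟩ := h
    exact Or.inl fun j => Subsingleton.elim i j ▸ hi
  · push Not at h
    exact Or.inr fun j => (h j).le

theorem card_properPart_chains_singleton {a : ℕ} (ha : a ≠ 0) :
    Nat.card (ProperPart (Chains {a})) = a - 1 := by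
  have := nontrivial_chains (σ := {a}) (by simpa using ha.symm) (by simp)
  have hcard : Nat.card (Chains {a}) = a + 1 := by
    rw [Nat.card_pi, Finset.prod_congr rfl fun i _ => Nat.card_fin _, Finset.prod,
      Multiset.map_univ {a} fun b : ℕ => b + 1]
    simp
  have := card_properPart_add_two (Chains {a})
  omega

end Chains

section Families

theorem exists_equiv_of_map_univ_eq {α β γ : Type*} [Fintype α] [Fintype β] {f : α → γ}
    {g : β → γ} (h : Finset.univ.val.map f = Finset.univ.val.map g) :
    ∃ e : α ≃ β, ∀ a, g (e a) = f a := by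
  classical
  have hfiber : ∀ c, Nonempty ({a // f a = c} ≃ {b // g b = c}) := by
    intro c
    refine Fintype.card_eq.1 ?_
    have hcount := congrArg (Multiset.count c) h
    rw [Multiset.count_map, Multiset.count_map] at hcount
    rw [Fintype.card_subtype, Fintype.card_subtype, Finset.card_def, Finset.card_def,
      Finset.filter_val, Finset.filter_val]
    simpa only [eq_comm] using hcount
  exact ⟨Equiv.ofFiberEquiv fun c => (hfiber c).some, Equiv.ofFiberEquiv_map _⟩

theorem map_univ_eq_of_equiv {α β γ : Type*} [Fintype α] [Fintype β] {f : α → γ}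
    {g : β → γ} (e : α ≃ β) (h : ∀ a, g (e a) = f a) :
    Finset.univ.val.map f = Finset.univ.val.map g := by
  rw [← Finset.map_univ_equiv e, Finset.map_val, Multiset.map_map]
  exact Multiset.map_congr rfl fun a _ => (h a).symm

end Families

section JoinGraph

/-- The graph whose independence complex is the join of the complexes `K_σ` for a family of
multisets `σ`. -/
abbrev joinGraph {J : Type*} (s : J → Multiset ℕ) :
    SimpleGraph (Σ j, ProperPart (Chains (s j))) :=
  sigmaGraph fun j => partitionGraph (s j)

/-- The combinatorial type of the join of the complexes `K_σ` for the elements `σ` of a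
multiset. -/
def joinType (M : Multiset (Multiset ℕ)) : CombType :=
  combType (indepComplex (joinGraph fun i : M.ToType => i.1) Set.univ)

theorem join_orderComplex_eq {J : Type*} (s : J → Multiset ℕ) :
    (join fun j => orderComplex (ProperPart (Chains (s j)))) =
      indepComplex (joinGraph s) Set.univ := by
  simp only [orderComplex_eq_indepComplex, join_indepComplex]

/-- The isomorphism between the graphs of equal multisets. -/
def partitionGraphCongr {σ τ : Multiset ℕ} (h : σ = τ) : partitionGraph σ ≃g partitionGraph τ :=
  h ▸ SimpleGraph.Iso.refl

theorem nonempty_joinGraph_iso {J J' : Type*} [Fintype J] [Fintype J'] {s : J → Multiset ℕ}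
    {t : J' → Multiset ℕ} (h : Finset.univ.val.map s = Finset.univ.val.map t) :
    Nonempty (joinGraph s ≃g joinGraph t) := by
  obtain ⟨e, he⟩ := exists_equiv_of_map_univ_eq h
  exact ⟨sigmaGraphCongr e fun j => partitionGraphCongr (he j).symm⟩

theorem combType_joinGraph {J : Type} [Fintype J] (s : J → Multiset ℕ) :
    combType (indepComplex (joinGraph s) Set.univ) = joinType (Finset.univ.val.map s) :=
  combType_indepComplex_univ_eq_iff.2
    (nonempty_joinGraph_iso (Multiset.map_univ_coe (Finset.univ.val.map s)).symm)

/-- A multiset that indexes a complex `K_σ` with connected incomparability graph: it has at least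
two positive parts, or `K_σ` is a point. -/
def IsIndecomposable (σ : Multiset ℕ) : Prop := 0 ∉ σ ∧ (2 ≤ σ.card ∨ σ = {2})

theorem IsIndecomposable.ne_zero {σ : Multiset ℕ} (h : IsIndecomposable σ) : σ ≠ 0 := by
  rintro rfl
  simp [IsIndecomposable] at h

theorem IsIndecomposable.connected {σ : Multiset ℕ} (h : IsIndecomposable σ) :
    (partitionGraph σ).Connected := by
  obtain ⟨h0, h2 | rfl⟩ := h
  · exact connected_partitionGraph h0 h2
  · obtain ⟨_, _⟩ := Nat.card_eq_one_iff_unique.1 (card_properPart_chains_singleton two_ne_zero)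
    exact ⟨SimpleGraph.Preconnected.of_subsingleton⟩

theorem joinType_injOn : Set.InjOn joinType {M | ∀ σ ∈ M, IsIndecomposable σ} := by
  intro M hM N hN h
  obtain ⟨φ⟩ := combType_indepComplex_univ_eq_iff.1 h
  obtain ⟨e, he⟩ := exists_iso_of_sigmaGraph_iso
    (fun i => (hM _ Multiset.coe_mem).connected) (fun i => (hN _ Multiset.coe_mem).connected) φ
  rw [← Multiset.map_univ_coe M, ← Multiset.map_univ_coe N]
  refine map_univ_eq_of_equiv e fun i => ?_
  have hi := hM _ (Multiset.coe_mem (x := i))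
  have hei := hN _ (Multiset.coe_mem (x := e i))
  exact (eq_of_partitionGraph_iso hi.1 hei.1 hi.ne_zero hei.ne_zero (he i).some).symm

/-- The join-irreducible factors of `K_σ`: if `σ` has a single part `a`, then `K_σ` is a simplex,
the join of its `a - 1` vertices, each of which is the complex of the partition `{2}`. -/
def factors (σ : Multiset ℕ) : Multiset (Multiset ℕ) :=
  if 2 ≤ σ.card then {σ} else Multiset.replicate (σ.sum - 1) {2}

theorem isIndecomposable_of_mem_factors {σ τ : Multiset ℕ} (hσ : 0 ∉ σ) (hτ : τ ∈ factors σ) :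
    IsIndecomposable τ := by
  unfold factors at hτ
  split_ifs at hτ with h
  · obtain rfl := Multiset.mem_singleton.1 hτ
    exact ⟨hσ, Or.inl h⟩
  · obtain rfl := Multiset.eq_of_mem_replicate hτ
    exact ⟨by simp, Or.inr rfl⟩

theorem nonempty_joinGraph_replicate_iso (n : ℕ) {V : Type*} (hV : Nat.card V = n) [Finite V] :
    Nonempty ((⊥ : SimpleGraph V) ≃g
      joinGraph fun i : (Multiset.replicate n ({2} : Multiset ℕ)).ToType => i.1) := by
  have := Fintype.ofFinite V
  have hpoint : Nat.card Unit = Nat.card (ProperPart (Chains {2})) :=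
    Nat.card_unique.trans (card_properPart_chains_singleton two_ne_zero).symm
  have e : (⊥ : SimpleGraph Unit) ≃g partitionGraph {2} := by
    rw [partitionGraph_eq_bot (by simp)]
    exact ⟨(Finite.card_eq.1 hpoint).some, by simp⟩
  have hmap : (Finset.univ.val.map fun _ : V => ({2} : Multiset ℕ)) =
      Finset.univ.val.map fun i : (Multiset.replicate n ({2} : Multiset ℕ)).ToType => i.1 := by
    rw [Multiset.map_univ_coe, Multiset.map_const', ← hV, Nat.card_eq_fintype_card]
    rfl
  obtain ⟨f⟩ := nonempty_joinGraph_iso hmap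
  exact ⟨((botIsoSigmaGraph V).trans (sigmaGraphCongr (Equiv.refl V) fun _ => e)).trans f⟩

theorem nonempty_joinGraph_factors_iso {σ : Multiset ℕ} (hσ : 0 ∉ σ) (h0 : σ ≠ 0) :
    Nonempty (joinGraph (fun i : (factors σ).ToType => i.1) ≃g
      partitionGraph σ) := by
  by_cases h : 2 ≤ σ.card
  · have hfactors : factors σ = {σ} := if_pos h
    have hmap : (Finset.univ.val.map fun i : (factors σ).ToType => i.1) =
        Finset.univ.val.map fun _ : Unit => σ := by
      rw [Multiset.map_univ_coe, hfactors]
      rfl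
    have e : joinGraph (fun _ : Unit => σ) ≃g partitionGraph σ := sigmaGraphUnique _
    obtain ⟨f⟩ := nonempty_joinGraph_iso hmap
    exact ⟨f.trans e⟩
  · have hcard : σ.card = 1 := by
      have := Multiset.card_pos.2 h0
      omega
    obtain ⟨a, rfl⟩ := Multiset.card_eq_one.1 hcard
    have hfactors : factors {a} = Multiset.replicate (a - 1) {2} := by
      rw [factors, if_neg h, Multiset.sum_singleton]
    rw [partitionGraph_eq_bot (by simp), hfactors]
    have : Finite (ProperPart (Chains {a})) := inferInstance
    obtain ⟨e⟩ := nonempty_joinGraph_replicate_iso (a - 1)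
      (card_properPart_chains_singleton (by simpa [eq_comm] using hσ))
    exact ⟨e.symm⟩

theorem joinType_bind_factors {M : Multiset (Multiset ℕ)} (hM : ∀ σ ∈ M, 0 ∉ σ ∧ σ ≠ 0) :
    joinType (M.bind factors) = joinType M := by
  have hmap : M.bind factors =
      Finset.univ.val.map fun x : Σ i : M.ToType, (factors i.1).ToType => x.2.1 := by
    change _ = Multiset.map _ (Finset.univ.val.bind fun _ => Finset.univ.val.map _)
    rw [Multiset.map_bind]
    conv_lhs => rw [← Multiset.map_univ_coe M, Multiset.bind_map]
    refine Multiset.bind_congr fun i _ => ?_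
    rw [Multiset.map_map]
    exact (Multiset.map_univ_coe (factors i.1)).symm
  rw [hmap, ← combType_joinGraph]
  refine combType_indepComplex_univ_eq_iff.2 ⟨(sigmaGraphAssoc
    fun (i : M.ToType) (k : (factors i.1).ToType) =>
      partitionGraph k.1).trans
    (sigmaGraphCongr (Equiv.refl _) fun i => ?_)⟩
  have hi := hM i.1 Multiset.coe_mem
  exact (nonempty_joinGraph_factors_iso hi.1 hi.2).some

end JoinGraph

section IndepNum

theorem hasDim_indepComplex_univ_iff {V : Type*} [Finite V] {G : SimpleGraph V} {t : ℕ} :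
    HasDim (indepComplex G Set.univ) t ↔ G.indepNum = t + 1 := by
  obtain ⟨s, hs⟩ := G.exists_isNIndepSet_indepNum
  have hle : ∀ F ∈ (indepComplex G Set.univ).faces, F.card ≤ G.indepNum := fun F hF =>
    SimpleGraph.IsIndepSet.card_le_indepNum hF.2.2
  have hs_face : 0 < G.indepNum → s ∈ (indepComplex G Set.univ).faces := fun h =>
    ⟨Finset.card_pos.1 (hs.card_eq ▸ h), Set.subset_univ _, hs.isIndepSet⟩
  constructor
  · rintro ⟨⟨F, hF, hcard⟩, hmax⟩
    have hF' := hle F hF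
    refine le_antisymm ?_ (hcard ▸ hF')
    exact hmax ⟨s, hs_face (by omega), hs.card_eq⟩
  · intro h
    refine ⟨⟨s, hs_face (by omega), hs.card_eq.trans h⟩, ?_⟩
    rintro _ ⟨F, hF, rfl⟩
    exact h ▸ hle F hF

theorem indepNum_sigmaGraph {J : Type*} [Fintype J] {V : J → Type*} [∀ j, Finite (V j)]
    (G : ∀ j, SimpleGraph (V j)) : (sigmaGraph G).indepNum = ∑ j, (G j).indepNum := by
  classical
  apply le_antisymm
  · obtain ⟨s, hs⟩ := (sigmaGraph G).exists_isNIndepSet_indepNum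
    rw [← hs.card_eq, ← Finset.sigma_preimage_mk_of_subset s (Finset.subset_univ _),
      Finset.card_sigma]
    refine Finset.sum_le_sum fun j _ => SimpleGraph.IsIndepSet.card_le_indepNum ?_
    intro a ha b hb hab hadj
    rw [Finset.coe_preimage] at ha hb
    exact hs.isIndepSet ha hb (sigma_mk_injective.ne hab) (sigmaGraph_adj_mk.2 hadj)
  · choose s hs using fun j => (G j).exists_isNIndepSet_indepNum
    simp only [← (hs _).card_eq]
    rw [← Finset.card_sigma]
    refine SimpleGraph.IsIndepSet.card_le_indepNum ?_
    rintro ⟨i, a⟩ ha ⟨j, b⟩ hb - hadj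
    obtain rfl : i = j := fst_eq_of_sigmaGraph_adj hadj
    have hab := sigmaGraph_adj_mk.1 hadj
    exact (hs i).isIndepSet (by simpa using ha) (by simpa using hb) hab.ne hab

end IndepNum

section Rank

variable {ι : Type*} [Fintype ι] {d : ι → ℕ}

theorem sum_toType (σ : Multiset ℕ) : ∑ i : σ.ToType, i.1 = σ.sum := by
  conv_rhs => rw [← Multiset.map_univ_coe σ]
  rfl

/-- The rank function of a product of chains. -/
def rank (x : ∀ i, Fin (d i + 1)) : ℕ := ∑ i, (x i : ℕ)

theorem rank_strictMono : StrictMono (rank (d := d)) := by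
  intro x y h
  obtain ⟨hle, i, hi⟩ := Pi.lt_def.1 h
  exact Finset.sum_lt_sum (fun i _ => hle i) ⟨i, Finset.mem_univ i, hi⟩

theorem rank_bot : rank (⊥ : ∀ i, Fin (d i + 1)) = 0 :=
  Finset.sum_eq_zero fun _ _ => rfl

theorem rank_top : rank (⊤ : ∀ i, Fin (d i + 1)) = ∑ i, d i :=
  rfl

theorem rank_top_chains (σ : Multiset ℕ) : rank (⊤ : Chains σ) = σ.sum :=
  sum_toType σ

theorem exists_le_rank_eq_add_one {x : ∀ i, Fin (d i + 1)} (h : x ≠ ⊤) :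
    ∃ y, x ≤ y ∧ rank y = rank x + 1 := by
  classical
  obtain ⟨i, hi⟩ := Function.ne_iff.1 h
  have hlt : (x i : ℕ) < d i := lt_top_iff_ne_top.2 hi
  refine ⟨fun k => ⟨x k + if k = i then 1 else 0, ?_⟩, fun k => Nat.le_add_right _ _, ?_⟩
  · split_ifs with hk
    · subst hk
      omega
    · exact (x k).2
  · simp [rank, Finset.sum_add_distrib]

theorem exists_monotone_rank_eq (d : ι → ℕ) :
    ∃ f : ℕ → ∀ i, Fin (d i + 1), Monotone f ∧ ∀ a ≤ ∑ i, d i, rank (f a) = a := by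
  have hsucc : ∀ x : ∀ i, Fin (d i + 1), ∃ y, x ≤ y ∧ (x ≠ ⊤ → rank y = rank x + 1) := by
    intro x
    by_cases h : x = ⊤
    · exact ⟨x, le_rfl, fun h' => absurd h h'⟩
    · obtain ⟨y, hxy, hy⟩ := exists_le_rank_eq_add_one h
      exact ⟨y, hxy, fun _ => hy⟩
  choose next hle hnext using hsucc
  refine ⟨fun a => next^[a] ⊥, monotone_nat_of_le_succ fun a => ?_, fun a ha => ?_⟩
  · rw [Function.iterate_succ_apply']
    exact hle _
  · induction a with
    | zero => exact rank_bot
    | succ a ih =>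
      have hrank : rank (next^[a] ⊥) = a := ih (by omega)
      change rank (next^[a + 1] ⊥) = a + 1
      rw [Function.iterate_succ_apply', hnext, hrank]
      intro htop
      rw [htop, rank_top] at hrank
      omega

theorem indepNum_partitionGraph_le (σ : Multiset ℕ) :
    (partitionGraph σ).indepNum ≤ σ.sum - 1 := by
  obtain ⟨s, hs⟩ := (partitionGraph σ).exists_isNIndepSet_indepNum
  have hcard : (Finset.Ioo 0 σ.sum).card = σ.sum - 1 := Nat.card_Ioo 0 σ.sum
  rw [← hs.card_eq, ← hcard]
  refine Finset.card_le_card_of_injOn (fun x => rank x.1) (fun x _ => ?_) fun x hx y hy hxy => ?_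
  · rw [Finset.coe_Ioo, Set.mem_Ioo]
    exact ⟨rank_bot.symm.trans_lt (rank_strictMono (bot_lt_iff_ne_bot.2 x.2.1)),
      (rank_strictMono (lt_top_iff_ne_top.2 x.2.2)).trans_eq (rank_top_chains σ)⟩
  · by_contra hne
    rcases not_incompGraph_adj.1 (hs.isIndepSet hx hy hne) with h | h
    · exact (rank_strictMono (lt_of_le_of_ne h (Subtype.coe_ne_coe.2 hne))).ne hxy
    · exact (rank_strictMono (lt_of_le_of_ne h (Subtype.coe_ne_coe.2 (Ne.symm hne)))).ne hxy.symm

theorem indepNum_partitionGraph (σ : Multiset ℕ) : (partitionGraph σ).indepNum = σ.sum - 1 := by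
  classical
  apply le_antisymm (indepNum_partitionGraph_le σ)
  obtain ⟨f, hf, hrank⟩ := exists_monotone_rank_eq fun i : σ.ToType => i.1
  rw [sum_toType] at hrank
  have hproper : ∀ a : Fin (σ.sum - 1), f (a + 1) ≠ ⊥ ∧ f (a + 1) ≠ ⊤ := by
    refine fun a => ⟨fun h => ?_, fun h => ?_⟩ <;>
      have ha := hrank (a + 1) (by omega)
    · rw [h, rank_bot] at ha
      omega
    · rw [h] at ha
      have hsum := ha.symm.trans (rank_top_chains σ)
      omega
  let c : Fin (σ.sum - 1) → ProperPart (Chains σ) := fun a => ⟨f (a + 1), hproper a⟩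
  have hc : Function.Injective c := fun a b hab => by
    have h := congrArg (fun x => rank x.1) hab
    simp only [c] at h
    rw [hrank _ (by omega), hrank _ (by omega)] at h
    exact Fin.ext (by omega)
  rw [← Fintype.card_fin (σ.sum - 1), ← Finset.card_univ,
    ← Finset.card_image_of_injective _ hc]
  refine SimpleGraph.IsIndepSet.card_le_indepNum ?_
  rintro x hx y hy -
  obtain ⟨a, -, rfl⟩ := Finset.mem_image.1 (Finset.mem_coe.1 hx)
  obtain ⟨b, -, rfl⟩ := Finset.mem_image.1 (Finset.mem_coe.1 hy)
  exact not_incompGraph_adj.2 ((le_total a b).imp (fun h => hf (Nat.add_le_add_right h 1))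
    fun h => hf (Nat.add_le_add_right h 1))

end Rank

section Weighted

variable {A : Type*} (w : A → ℕ)

/-- The union of multisets in the fibres of `w`, the fibre over `n` containing as many elements as
the prescribed multiset `m` of weights contains copies of `n`. -/
def glueFibers (m : Multiset ℕ) (f : ∀ n : m.toFinset, Sym {a // w a = n.1} (m.count n.1)) :
    Multiset A :=
  ∑ n, (f n).1.map Subtype.val

theorem map_glueFibers (m : Multiset ℕ)
    (f : ∀ n : m.toFinset, Sym {a // w a = n.1} (m.count n.1)) :
    (glueFibers w m f).map w = m := by
  classical
  have hfiber : ∀ n : m.toFinset, ((f n).1.map Subtype.val).map w = m.count n.1 • {n.1} := by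
    intro n
    rw [Multiset.map_map, Multiset.nsmul_singleton]
    refine Multiset.eq_replicate.2 ⟨by simp, fun b hb => ?_⟩
    obtain ⟨a, -, rfl⟩ := Multiset.mem_map.1 hb
    exact a.2
  refine (map_sum (Multiset.mapAddMonoidHom w) (fun n => (f n).1.map Subtype.val) _).trans ?_
  simp only [Multiset.coe_mapAddMonoidHom, hfiber]
  rw [Finset.sum_coe_sort m.toFinset fun n => m.count n • ({n} : Multiset ℕ)]
  exact Multiset.toFinset_sum_count_nsmul_eq m

theorem count_glueFibers [DecidableEq A] (m : Multiset ℕ)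
    (f : ∀ n : m.toFinset, Sym {a // w a = n.1} (m.count n.1)) (n : m.toFinset)
    (a : {a // w a = n.1}) : (glueFibers w m f).count a.1 = (f n).1.count a := by
  rw [glueFibers, Multiset.count_sum', Finset.sum_eq_single n]
  · exact Multiset.count_map_eq_count' _ _ Subtype.val_injective _
  · intro k _ hk
    refine Multiset.count_eq_zero_of_notMem fun h => hk ?_
    obtain ⟨b, -, hb⟩ := Multiset.mem_map.1 h
    refine Subtype.ext ?_
    rw [← b.2, hb, a.2]
  · simp

theorem glueFibers_injective (m : Multiset ℕ) : Function.Injective (glueFibers w m) := by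
  classical
  intro f f' h
  funext n
  refine Subtype.ext (Multiset.ext.2 fun a => ?_)
  rw [← count_glueFibers, h, count_glueFibers]

theorem exists_glueFibers_eq (M : Multiset A) : ∃ f, glueFibers w (M.map w) f = M := by
  classical
  have hfilter : ∀ n : (M.map w).toFinset, ∃ N : Sym {a // w a = n.1} ((M.map w).count n.1),
      N.1.map Subtype.val = M.filter fun a => w a = n.1 := by
    intro n
    have hN : ∀ a ∈ M.filter fun a => w a = n.1, w a = n.1 := fun a ha =>
      (Multiset.mem_filter.1 ha).2
    lift (M.filter fun a => w a = n.1) to Multiset {a // w a = n.1} using hN with N hN'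
    refine ⟨⟨N, ?_⟩, rfl⟩
    rw [Multiset.count_map, ← Multiset.card_map Subtype.val N, hN']
    simp only [eq_comm]
  choose f hf using hfilter
  refine ⟨f, Multiset.ext.2 fun a => ?_⟩
  by_cases ha : a ∈ M
  · have hmem : w a ∈ (M.map w).toFinset := Multiset.mem_toFinset.2 (Multiset.mem_map_of_mem w ha)
    rw [count_glueFibers w _ f ⟨w a, hmem⟩ ⟨a, rfl⟩]
    rw [← Multiset.count_map_eq_count' Subtype.val _ Subtype.val_injective, hf,
      Multiset.count_filter_of_pos (p := fun b => w b = w a) rfl]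
  · rw [Multiset.count_eq_zero_of_notMem ha]
    refine Multiset.count_eq_zero_of_notMem fun h => ha ?_
    obtain ⟨n, -, hn⟩ := Multiset.mem_sum.1 h
    rw [hf] at hn
    exact Multiset.mem_of_mem_filter hn

/-- A multiset with given weights consists of multisets in the fibres. -/
noncomputable def glueEquiv (m : Multiset ℕ) :
    (∀ n : m.toFinset, Sym {a // w a = n.1} (m.count n.1)) ≃ {M : Multiset A // M.map w = m} := by
  refine Equiv.ofBijective (fun f => ⟨glueFibers w m f, map_glueFibers w m f⟩) ⟨?_, ?_⟩
  · intro f f' h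
    exact glueFibers_injective w m (congrArg Subtype.val h)
  · rintro ⟨M, rfl⟩
    obtain ⟨f, hf⟩ := exists_glueFibers_eq w M
    exact ⟨f, Subtype.ext hf⟩

theorem finite_map_eq {m : Multiset ℕ} (hfin : ∀ n ∈ m, Finite {a // w a = n}) :
    Finite {M : Multiset A // M.map w = m} := by
  have : ∀ n : m.toFinset, Finite {a // w a = n.1} := fun n =>
    hfin n.1 (Multiset.mem_toFinset.1 n.2)
  exact Finite.of_equiv _ (glueEquiv w m)

theorem card_map_eq {m : Multiset ℕ} (hfin : ∀ n ∈ m, Finite {a // w a = n}) :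
    Nat.card {M : Multiset A // M.map w = m} =
      ∏ n ∈ m.toFinset, (Nat.card {a // w a = n}).multichoose (m.count n) := by
  classical
  rw [← Nat.card_congr (glueEquiv w m), Nat.card_pi, ← Finset.prod_coe_sort m.toFinset
    fun n => (Nat.card {a // w a = n}).multichoose (m.count n)]
  refine Finset.prod_congr rfl fun n _ => ?_
  have := hfin n.1 (Multiset.mem_toFinset.1 n.2)
  have := Fintype.ofFinite {a // w a = n.1}
  rw [Nat.card_eq_fintype_card, Sym.card_sym_eq_multichoose, Nat.card_eq_fintype_card]

/-- Multisets of weight `t` are multisets over partitions of `t`. -/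
def weightEquiv (hw : ∀ a, 0 < w a) (t : ℕ) : {M : Multiset A // (M.map w).sum = t} ≃
    Σ μ : t.Partition, {M : Multiset A // M.map w = μ.parts} where
  toFun M := ⟨⟨M.1.map w, fun {i} hi => by
    obtain ⟨a, -, rfl⟩ := Multiset.mem_map.1 hi
    exact hw a, M.2⟩, M.1, rfl⟩
  invFun M := ⟨M.2.1, by rw [M.2.2, M.1.parts_sum]⟩
  left_inv M := rfl
  right_inv := by
    rintro ⟨⟨p, h1, h2⟩, M, hM⟩
    change M.map w = p at hM
    subst hM
    rfl

theorem encard_sum_map_eq (hw : ∀ a, 0 < w a) (hfin : ∀ n, 0 < n → Finite {a // w a = n}) (t : ℕ) :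
    {M : Multiset A | (M.map w).sum = t}.encard =
      ((∑ μ : t.Partition, ∏ n ∈ μ.parts.toFinset,
        (Nat.card {a // w a = n}).multichoose (μ.parts.count n) : ℕ) : ℕ∞) := by
  have hparts : ∀ μ : t.Partition, ∀ n ∈ μ.parts, Finite {a // w a = n} := fun μ n hn =>
    hfin n (μ.parts_pos hn)
  have : ∀ μ : t.Partition, Finite {M : Multiset A // M.map w = μ.parts} := fun μ =>
    finite_map_eq w (hparts μ)
  rw [← ENat.card_coe_set_eq]
  change ENat.card {M : Multiset A // (M.map w).sum = t} = _
  rw [ENat.card_congr (weightEquiv w hw t), ENat.card_eq_coe_natCard, Nat.card_sigma]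
  exact congrArg _ (Finset.sum_congr rfl fun μ _ => card_map_eq w (hparts μ))

end Weighted

section JoinTypes

/-- The multisets formed by the parts of a partition with at least two parts. -/
def IsMultipart (σ : Multiset ℕ) : Prop := 0 ∉ σ ∧ 2 ≤ σ.card

theorem IsMultipart.isIndecomposable {σ : Multiset ℕ} (h : IsMultipart σ) : IsIndecomposable σ :=
  ⟨h.1, Or.inl h.2⟩

theorem card_le_sum {σ : Multiset ℕ} (h : 0 ∉ σ) : σ.card ≤ σ.sum := by
  simpa using Multiset.card_nsmul_le_sum (a := 1) fun a ha =>
    Nat.pos_of_ne_zero fun h0 => h (h0 ▸ ha)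

theorem IsIndecomposable.two_le_sum {σ : Multiset ℕ} (h : IsIndecomposable σ) : 2 ≤ σ.sum := by
  obtain ⟨h0, h2 | rfl⟩ := h
  · exact h2.trans (card_le_sum h0)
  · rfl

/-- The weight of a multiset of partitions: one more than the dimension of the join of the
complexes `K_σ` for its elements `σ`. -/
def weight (M : Multiset (Multiset ℕ)) : ℕ := (M.map fun σ => σ.sum - 1).sum

variable {r : ℕ} {n : Fin r → ℕ} (σ : ∀ i, (n i).Partition)

theorem join_partitionComplex_eq : (join fun i => partitionComplex (σ i)) =
    indepComplex (joinGraph fun i => (σ i).parts) Set.univ :=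
  join_orderComplex_eq fun i => (σ i).parts

theorem hasDim_join_partitionComplex_iff {t : ℕ} :
    HasDim (join fun i => partitionComplex (σ i)) t ↔
      weight (Finset.univ.val.map fun i => (σ i).parts) = t + 1 := by
  rw [join_partitionComplex_eq, hasDim_indepComplex_univ_iff, indepNum_sigmaGraph, weight,
    Multiset.map_map]
  simp only [indepNum_partitionGraph]
  rfl

theorem combType_join_partitionComplex :
    combType (join fun i => partitionComplex (σ i)) =
      joinType (Finset.univ.val.map fun i => (σ i).parts) := by
  rw [join_partitionComplex_eq, combType_joinGraph]

theorem exists_partitions_of_isMultipart {M : Multiset (Multiset ℕ)}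
    (hM : ∀ τ ∈ M, IsMultipart τ) :
    ∃ (r : ℕ) (n : Fin r → ℕ) (σ : ∀ i, (n i).Partition), (∀ i, 2 ≤ (σ i).parts.card) ∧
      (Finset.univ.val.map fun i => (σ i).parts) = M := by
  let e := (Fintype.equivFin M.ToType).symm
  refine ⟨_, _, fun i => ⟨(e i).1, fun {a} ha => Nat.pos_of_ne_zero fun h0 =>
    (hM _ Multiset.coe_mem).1 (h0 ▸ ha), rfl⟩, fun i => (hM _ Multiset.coe_mem).2, ?_⟩
  conv_rhs => rw [← Multiset.map_univ_coe M]
  exact map_univ_eq_of_equiv e fun _ => rfl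

theorem joinTypes_eq_image_joinType (t : ℕ) :
    joinTypes t = joinType '' {M | (∀ σ ∈ M, IsMultipart σ) ∧ weight M = t + 1} := by
  ext c
  constructor
  · rintro ⟨r, n, σ, hcard, hdim, rfl⟩
    refine ⟨_, ⟨fun τ hτ => ?_, (hasDim_join_partitionComplex_iff σ).1 hdim⟩,
      (combType_join_partitionComplex σ).symm⟩
    obtain ⟨i, -, rfl⟩ := Multiset.mem_map.1 hτ
    exact ⟨fun h => lt_irrefl 0 ((σ i).parts_pos h), hcard i⟩
  · rintro ⟨M, ⟨hM, hw⟩, rfl⟩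
    obtain ⟨r, n, σ, hcard, rfl⟩ := exists_partitions_of_isMultipart hM
    exact ⟨r, n, σ, hcard, (hasDim_join_partitionComplex_iff σ).2 hw,
      (combType_join_partitionComplex σ).symm⟩

theorem Q_eq_encard (t : ℕ) :
    Q t = {M | (∀ σ ∈ M, IsMultipart σ) ∧ weight M = t + 1}.encard := by
  rw [Q, joinTypes_eq_image_joinType]
  exact (joinType_injOn.mono fun M hM σ hσ => (hM.1 σ hσ).isIndecomposable).encard_image

end JoinTypes

section CountByWeight

theorem card_partition_two_le (n : ℕ) :
    Nat.card {p : (n + 1).Partition // 2 ≤ p.parts.card} = Fintype.card (n + 1).Partition - 1 := by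
  classical
  have h1 : Nat.card {p : (n + 1).Partition // ¬ 2 ≤ p.parts.card} = 1 := by
    rw [Nat.card_eq_one_iff_exists]
    refine ⟨⟨Nat.Partition.indiscrete (n + 1), by simp⟩, ?_⟩
    rintro ⟨p, hp⟩
    refine Subtype.ext (Nat.Partition.ext ?_)
    have hne : p.parts ≠ 0 := fun h => by
      have := p.parts_sum
      simp [h] at this
    have hc : p.parts.card = 1 := by
      have := Multiset.card_pos.2 hne
      omega
    obtain ⟨a, ha⟩ := Multiset.card_eq_one.1 hc
    have := p.parts_sum
    rw [ha, Multiset.sum_singleton] at this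
    simp [ha, this]
  have h2 := Nat.card_congr (Equiv.sumCompl fun p : (n + 1).Partition => 2 ≤ p.parts.card)
  rw [Nat.card_sum, h1, Nat.card_eq_fintype_card (α := (n + 1).Partition)] at h2
  omega

/-- Multisets with at least two positive elements and sum `n + 1` are partitions. -/
def multipartEquiv {n : ℕ} (hn : 0 < n) : {σ : {σ // IsMultipart σ} // σ.1.sum - 1 = n} ≃
    {p : (n + 1).Partition // 2 ≤ p.parts.card} where
  toFun σ := ⟨⟨σ.1.1, fun {i} hi => Nat.pos_of_ne_zero fun h => σ.1.2.1 (h ▸ hi), by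
    have := σ.2
    omega⟩, σ.1.2.2⟩
  invFun p := ⟨⟨p.1.parts, fun h => lt_irrefl 0 (p.1.parts_pos h), p.2⟩, by
    simp [p.1.parts_sum]⟩
  left_inv σ := rfl
  right_inv p := rfl

theorem setOf_isMultipart_weight_eq (t : ℕ) :
    {M | (∀ σ ∈ M, IsMultipart σ) ∧ weight M = t} = Multiset.map Subtype.val ''
      {M : Multiset {σ // IsMultipart σ} | (M.map fun σ => σ.1.sum - 1).sum = t} := by
  ext M
  constructor
  · rintro ⟨hM, h⟩
    lift M to Multiset {σ // IsMultipart σ} using hM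
    rw [weight, Multiset.map_map] at h
    exact ⟨M, h, rfl⟩
  · rintro ⟨M, h, rfl⟩
    refine ⟨fun σ hσ => ?_, ?_⟩
    · obtain ⟨τ, -, rfl⟩ := Multiset.mem_map.1 hσ
      exact τ.2
    · rw [weight, Multiset.map_map]
      exact h

theorem encard_weight_eq (t : ℕ) :
    {M | (∀ σ ∈ M, IsMultipart σ) ∧ weight M = t}.encard =
      ((∑ μ : t.Partition, ∏ n ∈ μ.parts.toFinset,
        Nat.multichoose (Fintype.card (n + 1).Partition - 1) (μ.parts.count n) : ℕ) : ℕ∞) := by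
  have hpos : ∀ σ : {σ // IsMultipart σ}, 0 < σ.1.sum - 1 := fun σ =>
    Nat.sub_pos_of_lt σ.2.isIndecomposable.two_le_sum
  rw [setOf_isMultipart_weight_eq,
    (Multiset.map_injective Subtype.val_injective).encard_image,
    encard_sum_map_eq _ hpos fun n hn => Finite.of_equiv _ (multipartEquiv hn).symm]
  congr 1
  refine Finset.sum_congr rfl fun μ _ => Finset.prod_congr rfl fun n hn => ?_
  rw [Nat.card_congr (multipartEquiv (μ.parts_pos (Multiset.mem_toFinset.1 hn))),
    card_partition_two_le]

end CountByWeight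

section Gaps

variable {P : Type*} [PartialOrder P] {m : ℕ} {x : Fin (m + 2) → P}

theorem exists_mem_Ioo_of_not_adj [BoundedOrder P] (h0 : x 0 = ⊥) (h1 : x (Fin.last _) = ⊤) {y : P}
    (hy : ∀ j, ¬(incompGraph P).Adj (x j) y ∧ y ≠ x j) :
    ∃ j : Fin (m + 1), y ∈ Set.Ioo (x j.castSucc) (x j.succ) := by
  obtain ⟨j, hle, hnle⟩ : ∃ j : Fin (m + 1), x j.castSucc ≤ y ∧ ¬x j.succ ≤ y := by
    by_contra! hstep
    have hall : ∀ j, x j ≤ y := fun j =>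
      Fin.induction (h0.trans_le bot_le) (fun j ih => hstep j ih) j
    exact (hy (Fin.last _)).2 (le_antisymm (h1 ▸ le_top) (hall _))
  exact ⟨j, lt_of_le_of_ne hle (hy _).2.symm,
    lt_of_le_of_ne ((not_incompGraph_adj.1 (hy _).1).resolve_left hnle) (hy _).2⟩

theorem not_adj_and_ne_of_mem_Ioo (hx : StrictMono x) {j : Fin (m + 1)} {y : P}
    (hy : y ∈ Set.Ioo (x j.castSucc) (x j.succ)) (i : Fin (m + 2)) :
    ¬(incompGraph P).Adj (x i) y ∧ y ≠ x i := by
  rw [not_incompGraph_adj]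
  rcases lt_or_ge j.castSucc i with h | h
  · have hlt := hy.2.trans_le (hx.monotone (Fin.castSucc_lt_iff_succ_le.1 h))
    exact ⟨Or.inr hlt.le, hlt.ne⟩
  · have hlt := (hx.monotone h).trans_lt hy.1
    exact ⟨Or.inl hlt.le, hlt.ne'⟩

theorem nonempty_induce_iso_gaps [BoundedOrder P] (hx : StrictMono x) (h0 : x 0 = ⊥)
    (h1 : x (Fin.last _) = ⊤) :
    Nonempty ((sigmaGraph fun j : Fin (m + 1) => incompGraph (Set.Ioo (x j.castSucc) (x j.succ))) ≃g
      (incompGraph P).induce {y | ∀ j, ¬(incompGraph P).Adj (x j) y ∧ y ≠ x j}) := by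
  have hlt : ∀ {i j : Fin (m + 1)} {y z : P}, i < j → y ∈ Set.Ioo (x i.castSucc) (x i.succ) →
      z ∈ Set.Ioo (x j.castSucc) (x j.succ) → y < z := fun hij hy hz =>
    hy.2.trans ((hx.monotone (Fin.succ_le_castSucc_iff.2 hij)).trans_lt hz.1)
  have hne : ∀ {i j : Fin (m + 1)} {y z : P}, i ≠ j → y ∈ Set.Ioo (x i.castSucc) (x i.succ) →
      z ∈ Set.Ioo (x j.castSucc) (x j.succ) → y < z ∨ z < y := fun hij hy hz =>
    hij.lt_or_gt.imp (hlt · hy hz) (hlt · hz hy)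
  refine ⟨Equiv.ofBijective (fun u => ⟨u.2.1, not_adj_and_ne_of_mem_Ioo hx u.2.2⟩) ⟨?_, ?_⟩, ?_⟩
  · rintro ⟨i, y, hy⟩ ⟨j, z, hz⟩ h
    obtain rfl : y = z := congrArg Subtype.val h
    obtain rfl : i = j := by
      by_contra hij
      exact (hne hij hy hz).elim (lt_irrefl _) (lt_irrefl _)
    rfl
  · rintro ⟨y, hy⟩
    obtain ⟨j, hj⟩ := exists_mem_Ioo_of_not_adj h0 h1 hy
    exact ⟨⟨j, y, hj⟩, rfl⟩
  · rintro ⟨i, y, hy⟩ ⟨j, z, hz⟩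
    by_cases hij : i = j
    · subst hij
      rw [sigmaGraph_adj_mk]
      rfl
    · refine iff_of_false (not_incompGraph_adj.2 ?_) fun h => hij (fst_eq_of_sigmaGraph_adj h)
      exact (hne hij hy hz).imp le_of_lt le_of_lt

end Gaps

section Interval

/-- An open interval corresponds to the proper part of a bounded poset isomorphic to the closed
interval. -/
def incompGraphIooIso {P Q : Type*} [PartialOrder P] [PartialOrder Q] [BoundedOrder Q] {a b : P}
    (hab : a ≤ b) (F : Set.Icc a b ≃o Q) :
    incompGraph (Set.Ioo a b) ≃g incompGraph (ProperPart Q) :=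
  have hbot : F ⟨a, Set.left_mem_Icc.2 hab⟩ = ⊥ :=
    le_bot_iff.1 (F.le_symm_apply.1 (F.symm ⊥).2.1)
  have htop : F ⟨b, Set.right_mem_Icc.2 hab⟩ = ⊤ :=
    top_le_iff.1 (F.symm_apply_le.1 (F.symm ⊤).2.2)
  have key : ∀ y : Set.Icc a b, y.1 ∈ Set.Ioo a b ↔ F y ≠ ⊥ ∧ F y ≠ ⊤ := fun y => by
    rw [← hbot, ← htop, F.injective.ne_iff, F.injective.ne_iff, ne_eq, ne_eq, Subtype.ext_iff,
      Subtype.ext_iff, Set.mem_Ioo, y.2.1.lt_iff_ne', y.2.2.lt_iff_ne]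
  { toFun := fun y => ⟨F ⟨y.1, Set.Ioo_subset_Icc_self y.2⟩, (key _).1 y.2⟩
    invFun := fun z => ⟨(F.symm z.1).1, (key _).2 ((F.apply_symm_apply z.1).symm ▸ z.2)⟩
    left_inv := fun y => by simp only [F.symm_apply_apply]
    right_inv := fun z => by simp only [Subtype.coe_eta, F.apply_symm_apply]
    map_rel_iff' := by
      intro y z
      change (¬F _ ≤ F _ ∧ ¬F _ ≤ F _) ↔ _
      rw [F.le_iff_le, F.le_iff_le]
      rfl }

variable {ι : Type*} {d : ι → ℕ}

/-- A closed interval of a product of chains, translated to the origin. -/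
def iccOrderIso (a b : ∀ i, Fin (d i + 1)) (hab : a ≤ b) :
    Set.Icc a b ≃o ∀ i, Fin ((b i : ℕ) - (a i : ℕ) + 1) where
  toFun y i := ⟨(y.1 i : ℕ) - (a i : ℕ),
    Nat.lt_succ_of_le (Nat.sub_le_sub_right (y.2.2 i) _)⟩
  invFun z := ⟨fun i => ⟨a i + z i, by have := hab i; have := (b i).2; have := (z i).2; omega⟩,
    fun i => Nat.le_add_right _ _, fun i => by
      have : (a i : ℕ) ≤ b i := hab i
      have := (z i).2
      exact Fin.le_def.2 (by simp only; omega)⟩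
  left_inv y := Subtype.ext (funext fun i => Fin.ext (Nat.add_sub_cancel' (y.2.1 i)))
  right_inv z := funext fun i => Fin.ext (Nat.add_sub_cancel_left _ _)
  map_rel_iff' {y z} := forall_congr' fun i => by
    have : (a i : ℕ) ≤ z.1 i := z.2.1 i
    exact (tsub_le_tsub_iff_right this)

variable [Fintype ι]

/-- The nonzero values of a function. -/
def parts (e : ι → ℕ) : Multiset ℕ := (Finset.univ.val.map e).filter (· ≠ 0)

theorem zero_notMem_parts (e : ι → ℕ) : 0 ∉ parts e := by
  simp [parts]

theorem sum_parts (e : ι → ℕ) : (parts e).sum = ∑ i, e i := by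
  have h := Multiset.sum_filter_add_sum_filter_not (s := Finset.univ.val.map e) (· ≠ 0)
  have h2 : ((Finset.univ.val.map e).filter fun a => ¬ a ≠ 0).sum = 0 :=
    Multiset.sum_eq_zero fun a ha => not_not.1 (Multiset.mem_filter.1 ha).2
  rw [h2, add_zero] at h
  exact h

theorem exists_parts_equiv (e : ι → ℕ) :
    ∃ f : {i // e i ≠ 0} ≃ (parts e).ToType, ∀ i, (f i).1 = e i := by
  classical
  refine exists_equiv_of_map_univ_eq (f := fun i : {i // e i ≠ 0} => e i.1)
    (g := fun t : (parts e).ToType => t.1) ?_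
  rw [Multiset.map_univ_coe, parts, Multiset.filter_map]
  exact Finset.univ_val_map_subtype_restrict e fun i => e i ≠ 0

theorem nonempty_orderIso_chains_parts (e : ι → ℕ) :
    Nonempty ((∀ i, Fin (e i + 1)) ≃o Chains (parts e)) := by
  classical
  obtain ⟨f, hf⟩ := exists_parts_equiv e
  have hf' : ∀ t, e (f.symm t).1 = t.1 := fun t => by rw [← hf, f.apply_symm_apply]
  have hzero : ∀ (y : ∀ i, Fin (e i + 1)) i, e i = 0 → (y i : ℕ) = 0 := fun y i hi => by
    have := (y i).2
    omega
  let drop (y : ∀ i, Fin (e i + 1)) : Chains (parts e) := fun t =>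
    (y (f.symm t).1).cast (congrArg (· + 1) (hf' t))
  let extend (z : Chains (parts e)) : ∀ i, Fin (e i + 1) := fun i =>
    if h : e i = 0 then 0 else (z (f ⟨i, h⟩)).cast (congrArg (· + 1) (hf _))
  have hdrop : ∀ y i (h : e i ≠ 0), (drop y (f ⟨i, h⟩) : ℕ) = y i := fun y i h =>
    congrArg (fun j : {i // e i ≠ 0} => (y j.1 : ℕ)) (f.symm_apply_apply ⟨i, h⟩)
  have hextend : ∀ z i (h : e i ≠ 0), (extend z i : ℕ) = z (f ⟨i, h⟩) := fun z i h => by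
    simp [extend, h]
  refine ⟨⟨⟨drop, extend, fun y => ?_, fun z => ?_⟩, fun {y z} => ?_⟩⟩
  · refine funext fun i => Fin.ext ?_
    by_cases h : e i = 0
    · rw [hzero _ i h, hzero _ i h]
    · rw [hextend _ i h, hdrop]
  · refine funext fun t => Fin.ext ?_
    obtain ⟨⟨i, h⟩, rfl⟩ := f.surjective t
    rw [hdrop, hextend]
  · refine ⟨fun h i => ?_, fun h t => h (f.symm t).1⟩
    by_cases hi : e i = 0
    · exact Fin.le_def.2 (by rw [hzero _ i hi, hzero _ i hi])
    · exact Fin.le_def.2 (by rw [← hdrop y i hi, ← hdrop z i hi]; exact h _)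

theorem nonempty_iso_partitionGraph_parts {a b : ∀ i, Fin (d i + 1)} (hab : a ≤ b) :
    Nonempty (incompGraph (Set.Ioo a b) ≃g
      partitionGraph (parts fun i => (b i : ℕ) - (a i : ℕ))) := by
  obtain ⟨F⟩ := nonempty_orderIso_chains_parts fun i => (b i : ℕ) - (a i : ℕ)
  exact ⟨incompGraphIooIso hab ((iccOrderIso a b hab).trans F)⟩

theorem exists_parts_eq (ι : Type*) [Fintype ι] {s : Multiset ℕ} (h0 : 0 ∉ s)
    (h : s.card ≤ Fintype.card ι) : ∃ e : ι → ℕ, parts e = s := by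
  classical
  let t := s + Multiset.replicate (Fintype.card ι - s.card) 0
  have ht : Fintype.card ι = Fintype.card t.ToType := by
    rw [Multiset.card_coe, Multiset.card_add, Multiset.card_replicate]
    omega
  let f := Fintype.equivOfCardEq ht
  have hmap : Finset.univ.val.map (fun i => (f i).1) = t :=
    (map_univ_eq_of_equiv f fun _ => rfl).trans (Multiset.map_univ_coe t)
  refine ⟨fun i => (f i).1, ?_⟩
  rw [parts, hmap, Multiset.filter_add, Multiset.filter_eq_self.2, Multiset.filter_eq_nil.2,
    add_zero]
  · exact fun a ha => not_not.2 (Multiset.eq_of_mem_replicate ha)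
  · exact fun a ha h => h0 (h ▸ ha)

end Interval

section GapParts

variable {ι : Type*} [Fintype ι] {d : ι → ℕ} {m : ℕ} {x : Fin (m + 2) → ∀ i, Fin (d i + 1)}

/-- The nonzero coordinates of the `j`-th step `x (j + 1) - x j` of a chain in a product of
chains. -/
def gapParts (x : Fin (m + 2) → ∀ i, Fin (d i + 1)) (j : Fin (m + 1)) : Multiset ℕ :=
  parts fun i => (x j.succ i : ℕ) - (x j.castSucc i : ℕ)

theorem nonempty_induce_iso_joinGraph_gapParts (hx : StrictMono x) (h0 : x 0 = ⊥)
    (h1 : x (Fin.last _) = ⊤) :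
    Nonempty ((incompGraph (∀ i, Fin (d i + 1))).induce
      {y | ∀ j, ¬(incompGraph _).Adj (x j) y ∧ y ≠ x j} ≃g joinGraph (gapParts x)) := by
  obtain ⟨e⟩ := nonempty_induce_iso_gaps hx h0 h1
  have f : ∀ j : Fin (m + 1), incompGraph (Set.Ioo (x j.castSucc) (x j.succ)) ≃g
      partitionGraph (gapParts x j) := fun j =>
    (nonempty_iso_partitionGraph_parts (hx j.castSucc_lt_succ).le).some
  exact ⟨e.symm.trans (sigmaGraphCongr (Equiv.refl _) f)⟩

theorem sum_gapParts_add_rank (hx : Monotone x) (j : Fin (m + 1)) :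
    (gapParts x j).sum + rank (x j.castSucc) = rank (x j.succ) := by
  rw [gapParts, sum_parts, rank, rank, ← Finset.sum_add_distrib]
  exact Finset.sum_congr rfl fun i _ => Nat.sub_add_cancel (hx j.castSucc_lt_succ.le i)

theorem sum_sum_gapParts (hx : Monotone x) (h0 : x 0 = ⊥) (h1 : x (Fin.last _) = ⊤) :
    ∑ j, (gapParts x j).sum = ∑ i, d i := by
  have hstep := Finset.sum_congr rfl fun j (_ : j ∈ Finset.univ) => sum_gapParts_add_rank hx j
  rw [Finset.sum_add_distrib] at hstep
  have hsucc := Fin.sum_univ_succ fun j => rank (x j)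
  have hcastSucc := Fin.sum_univ_castSucc fun j => rank (x j)
  rw [h0, rank_bot] at hsucc
  rw [h1, rank_top] at hcastSucc
  omega

theorem gapParts_ne_zero (hx : StrictMono x) (j : Fin (m + 1)) : gapParts x j ≠ 0 := by
  intro h
  have hlt := rank_strictMono (hx j.castSucc_lt_succ)
  have hsum := sum_gapParts_add_rank hx.monotone j
  rw [h, Multiset.sum_zero] at hsum
  omega

theorem exists_chain_gapParts_eq (ι : Type*) [Fintype ι] (s : Fin (m + 1) → Multiset ℕ)
    (h0 : ∀ j, 0 ∉ s j) (hne : ∀ j, s j ≠ 0) (h : ∀ j, (s j).card ≤ Fintype.card ι) :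
    ∃ (d : ι → ℕ) (x : Fin (m + 2) → ∀ i, Fin (d i + 1)),
      StrictMono x ∧ x 0 = ⊥ ∧ x (Fin.last _) = ⊤ ∧ gapParts x = s := by
  choose e he using fun j => exists_parts_eq ι (h0 j) (h j)
  let S : Fin (m + 2) → ι → ℕ := Fin.partialSum e
  have hS : ∀ j : Fin (m + 1), S j.succ = S j.castSucc + e j := Fin.partialSum_succ e
  have hmono : Monotone S := Fin.monotone_iff_le_succ.2 fun j => by
    rw [hS]
    exact le_self_add
  let x : Fin (m + 2) → ∀ i, Fin (S (Fin.last _) i + 1) := fun j i =>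
    ⟨S j i, Nat.lt_succ_of_le (hmono (Fin.le_last j) i)⟩
  have hgap : gapParts x = s := funext fun j => by
    have hdiff : (fun i => (x j.succ i : ℕ) - (x j.castSucc i : ℕ)) = e j := funext fun i => by
      change S j.succ i - S j.castSucc i = e j i
      rw [hS, Pi.add_apply, Nat.add_sub_cancel_left]
    rw [gapParts, hdiff, he]
  have hx : StrictMono x := Fin.strictMono_iff_lt_succ.2 fun j =>
    lt_of_le_of_ne (fun i => hmono j.castSucc_lt_succ.le i) fun heq => hne j <| by
      rw [← hgap, gapParts, ← heq]
      simp [parts, Multiset.filter_eq_nil, Multiset.mem_replicate]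
  exact ⟨_, x, hx, funext fun i => Fin.ext (congrFun (Fin.partialSum_zero e) i), rfl, hgap⟩

end GapParts

section Near

variable {ι : Type*} {x y : ι → ℤ}

/-- Two integer points are near if one of them exceeds the other by a `0/1`-vector. -/
def Near (x y : ι → ℤ) : Prop := (x ≤ y ∧ y ≤ x + 1) ∨ (y ≤ x ∧ x ≤ y + 1)

theorem Near.symm (h : Near x y) : Near y x := Or.symm h

theorem Near.refl (x : ι → ℤ) : Near x x :=
  Or.inl ⟨le_rfl, fun i => by simp⟩

/-- The graph of the pairs of integer points that are not near. -/
def farGraph (ι : Type*) : SimpleGraph (ι → ℤ) where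
  Adj x y := ¬Near x y
  symm := ⟨fun _ _ h h' => h h'.symm⟩
  loopless := ⟨fun x h => h (Near.refl x)⟩

theorem not_farGraph_adj : ¬(farGraph ι).Adj x y ↔ Near x y := not_not

end Near

section Facets

theorem monotone_of_le_next {n : ℕ} {α : Type*} [Preorder α] {f : Fin n → α}
    (h : ∀ i j : Fin n, (j : ℕ) = i + 1 → f i ≤ f j) : Monotone f := by
  cases n with
  | zero => exact fun i => i.elim0
  | succ n => exact Fin.monotone_iff_le_succ.2 fun i => h _ _ (by simp)

theorem exists_forall_iff_le_val {n : ℕ} {P : Fin n → Prop} (h : ∀ i j, i ≤ j → P i → P j) :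
    ∃ a ≤ n, ∀ i, P i ↔ a ≤ (i : ℕ) := by
  classical
  have hn : ∀ i : Fin n, n ≤ (i : ℕ) → P i := fun i hi => absurd i.2 (not_lt.2 hi)
  have hex : ∃ a, ∀ i : Fin n, a ≤ (i : ℕ) → P i := ⟨n, hn⟩
  refine ⟨Nat.find hex, Nat.find_min' hex hn, fun i => ⟨fun hi => ?_, Nat.find_spec hex i⟩⟩
  exact Nat.find_min' hex fun j hj => h i j hj hi

variable {k q : ℕ} {v y z : Fin (k - 1) → ℤ} {π : Equiv.Perm (Fin (k - 1))}
  {s : Finset (Fin (k - 1) → ℤ)}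

theorem mem_vertices_of_mem_facet (hv : v ∈ vertices k q) (hv1 : v + 1 ∈ vertices k q)
    (hπ : Consistent v π) (hz : z ∈ facet v π) : z ∈ vertices k q := by
  obtain ⟨a, -, rfl⟩ := Finset.mem_image.1 hz
  refine ⟨monotone_of_le_next fun i j hij => ?_, fun i => ?_⟩
  · have hle : v i ≤ v j := hv.1 (Fin.le_def.2 (by omega))
    by_cases h : v i = v j
    · have hlt : (π.symm i : ℕ) < π.symm j := hπ i j hij h
      split_ifs <;> omega
    · split_ifs <;> omega
  · have hnonneg := (hv.2 i).1
    have hle := (hv1.2 i).2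
    simp only [Pi.add_apply, Pi.one_apply] at hle ⊢
    split_ifs <;> omega

theorem near_of_mem_facet (hy : y ∈ facet v π) (hz : z ∈ facet v π) : Near y z := by
  obtain ⟨a, -, rfl⟩ := Finset.mem_image.1 hy
  obtain ⟨b, -, rfl⟩ := Finset.mem_image.1 hz
  rcases le_total a b with h | h
  · refine Or.inr ⟨fun i => ?_, fun i => ?_⟩ <;> simp only [Pi.add_apply, Pi.one_apply] <;>
      split_ifs <;> omega
  · refine Or.inl ⟨fun i => ?_, fun i => ?_⟩ <;> simp only [Pi.add_apply, Pi.one_apply] <;>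
      split_ifs <;> omega

theorem mem_facet_of_forall (hle : v ≤ z) (hle_add : z ≤ v + 1)
    (h : ∀ i j, π.symm i ≤ π.symm j → z i = v i + 1 → z j = v j + 1) : z ∈ facet v π := by
  obtain ⟨a, ha, hiff⟩ := exists_forall_iff_le_val (P := fun i => z (π i) = v (π i) + 1)
    fun i j hij => h _ _ (by simpa using hij)
  refine Finset.mem_image.2 ⟨a, Finset.mem_range.2 (Nat.lt_succ_of_le ha), funext fun i => ?_⟩
  have hi := hiff (π.symm i)
  rw [Equiv.apply_symm_apply] at hi
  have hlo : v i ≤ z i := hle i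
  have hhi := hle_add i
  simp only [Pi.add_apply, Pi.one_apply] at hhi
  rw [if_congr hi.symm rfl rfl]
  split_ifs <;> omega

theorem exists_perm_symm_lt_iff {n : ℕ} (c : Fin n → ℕ) :
    ∃ π : Equiv.Perm (Fin n), ∀ i j, π.symm i < π.symm j ↔ c i < c j ∨ c i = c j ∧ i < j := by
  let f : Fin n → ℕ ×ₗ Fin n := fun i => toLex (c i, i)
  have hf : Function.Injective f := fun i j h => congrArg (fun p => (ofLex p).2) h
  have hmono : StrictMono (f ∘ Tuple.sort f) :=
    (Tuple.monotone_sort f).strictMono_of_injective (hf.comp (Tuple.sort f).injective)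
  refine ⟨Tuple.sort f, fun i j => ?_⟩
  rw [← hmono.lt_iff_lt, Function.comp_apply, Function.comp_apply, Equiv.apply_symm_apply,
    Equiv.apply_symm_apply, Prod.Lex.toLex_lt_toLex]

/-- The number of points of `s` that exceed `v` in the coordinate `i`, for points between `v` and
`v + 1`. -/
def raisedCount (v : Fin (k - 1) → ℤ) (s : Finset (Fin (k - 1) → ℤ)) (i : Fin (k - 1)) : ℕ :=
  (s.filter fun z => z i = v i + 1).card

theorem raisedCount_le_of_eq (hmono : ∀ z ∈ s, Monotone z) (hle_add : ∀ z ∈ s, z ≤ v + 1)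
    {i j : Fin (k - 1)} (hij : i ≤ j) (hv : v i = v j) :
    raisedCount v s i ≤ raisedCount v s j := by
  refine Finset.card_le_card (Finset.monotone_filter_right s fun z hz hi => ?_)
  have hle := hmono z hz hij
  have hj := hle_add z hz j
  simp only [Pi.add_apply, Pi.one_apply] at hj
  omega

theorem raisedCount_lt (hle_add : ∀ z ∈ s, z ≤ v + 1) (hchain : ∀ y ∈ s, ∀ z ∈ s, y ≤ z ∨ z ≤ y)
    (hz : z ∈ s) {i j : Fin (k - 1)} (hi : z i = v i + 1) (hj : z j ≠ v j + 1) :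
    raisedCount v s j < raisedCount v s i := by
  refine Finset.card_lt_card ⟨Finset.monotone_filter_right s fun y hy hyj => ?_, fun hsub => ?_⟩
  · have hzj := hle_add z hz j
    have hyi := hle_add y hy i
    simp only [Pi.add_apply, Pi.one_apply] at hzj hyi
    rcases hchain y hy z hz with h | h
    · have : y j ≤ z j := h j
      omega
    · have : z i ≤ y i := h i
      omega
  · exact hj (Finset.mem_filter.1 (hsub (Finset.mem_filter.2 ⟨hz, hi⟩))).2

theorem exists_consistent_subset_facet (hmono : ∀ z ∈ s, Monotone z) (hle : ∀ z ∈ s, v ≤ z)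
    (hle_add : ∀ z ∈ s, z ≤ v + 1) (hchain : ∀ y ∈ s, ∀ z ∈ s, y ≤ z ∨ z ≤ y) :
    ∃ π, Consistent v π ∧ s ⊆ facet v π := by
  obtain ⟨π, hπ⟩ := exists_perm_symm_lt_iff (raisedCount v s)
  refine ⟨π, fun i j hij hv => ?_, fun z hz => ?_⟩
  · have hlt : i < j := Fin.lt_def.2 (by omega)
    have hcount := raisedCount_le_of_eq hmono hle_add hlt.le hv
    exact (hπ i j).2 (hcount.lt_or_eq.imp id fun h => ⟨h, hlt⟩)
  · refine mem_facet_of_forall (hle z hz) (hle_add z hz) fun i j hij hi => ?_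
    by_contra hj
    exact hij.not_gt ((hπ j i).2 (Or.inl (raisedCount_lt hle_add hchain hz hi hj)))

theorem exists_forall_le_of_near (hne : s.Nonempty) (hnear : ∀ x ∈ s, ∀ y ∈ s, Near x y) :
    ∃ b ∈ s, ∀ z ∈ s, b ≤ z ∧ z ≤ b + 1 := by
  obtain ⟨b, hb⟩ := s.exists_minimal hne
  refine ⟨b, hb.1, fun z hz => ?_⟩
  rcases hnear b hb.1 z hz with h | h
  · exact h
  · exact ⟨hb.2 hz h.1, h.1.trans fun i => by simp⟩

theorem mem_edgewise_faces_of_near (hq : 1 ≤ q) (hne : s.Nonempty) (hs : ∀ x ∈ s, x ∈ vertices k q)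
    (hnear : ∀ x ∈ s, ∀ y ∈ s, Near x y) : s ∈ (edgewise k q).faces := by
  obtain ⟨b, hb, hbs⟩ := exists_forall_le_of_near hne hnear
  -- The smallest point `b` of `s` is truncated so that `v + 1` is still a vertex.
  let v : Fin (k - 1) → ℤ := fun i => min (b i) (q - 1)
  have hv : Monotone v := fun i j hij => min_le_min_right _ ((hs b hb).1 hij)
  obtain ⟨π, hπ, hsub⟩ := exists_consistent_subset_facet (v := v) (fun z hz => (hs z hz).1)
    (fun z hz i => (min_le_left _ _).trans ((hbs z hz).1 i))
    (fun z hz i => by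
      have hzq := ((hs z hz).2 i).2
      have hzb := (hbs z hz).2 i
      simp only [v, Pi.add_apply, Pi.one_apply] at hzb ⊢
      omega)
    fun y hy z hz => (hnear y hy z hz).imp And.left And.left
  refine ⟨hne, v, π, ⟨hv, fun i => ?_⟩, ⟨hv.add_const 1, fun i => ?_⟩, hπ, hsub⟩ <;>
    have := (hs b hb).2 i <;> simp only [v, Pi.add_apply, Pi.one_apply] <;> omega

theorem edgewise_eq_indepComplex (k : ℕ) (hq : 1 ≤ q) :
    edgewise k q = indepComplex (farGraph (Fin (k - 1))) (vertices k q) := by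
  ext s
  constructor
  · rintro ⟨hne, v, π, hv, hv1, hπ, hsub⟩
    exact ⟨hne, fun x hx => mem_vertices_of_mem_facet hv hv1 hπ (hsub hx), fun x hx y hy _ =>
      not_farGraph_adj.2 (near_of_mem_facet (hsub hx) (hsub hy))⟩
  · rintro ⟨hne, hs, hindep⟩
    refine mem_edgewise_faces_of_near hq hne (fun x hx => hs hx) fun x hx y hy => ?_
    by_cases h : x = y
    · exact h ▸ Near.refl x
    · exact not_farGraph_adj.1 (hindep hx hy h)

end Facets

section Fibers

variable {E L : Type*} {β : E → L} {ρ : E → ℤ}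

/-- Up-sets with respect to the order by `ρ` within each fibre of `β`. -/
def IsFiberwiseUpper (β : E → L) (ρ : E → ℤ) (A : Finset E) : Prop :=
  ∀ e e', β e = β e' → ρ e ≤ ρ e' → e ∈ A → e' ∈ A

theorem isFiberwiseUpper_univ [Fintype E] : IsFiberwiseUpper β ρ Finset.univ :=
  fun _ e' _ _ _ => Finset.mem_univ e'

theorem isFiberwiseUpper_empty : IsFiberwiseUpper β ρ ∅ :=
  fun _ _ _ _ h => absurd h (Finset.notMem_empty _)

theorem exists_upper_subset_card_eq (hρ : Function.Injective ρ) (F : Finset E) {c : ℕ}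
    (hc : c ≤ F.card) :
    ∃ A ⊆ F, A.card = c ∧ ∀ e ∈ A, ∀ e' ∈ F, ρ e ≤ ρ e' → e' ∈ A := by
  classical
  induction c with
  | zero => exact ⟨∅, F.empty_subset, rfl, fun e he => absurd he (Finset.notMem_empty e)⟩
  | succ c ih =>
    obtain ⟨A, hAF, hcard, hupper⟩ := ih (Nat.le_of_succ_le hc)
    obtain ⟨e₀, he₀, hmax⟩ := (F \ A).exists_max_image ρ <| by
      rw [← Finset.card_pos, Finset.card_sdiff_of_subset hAF]
      omega
    obtain ⟨heF, heA⟩ := Finset.mem_sdiff.1 he₀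
    refine ⟨insert e₀ A, Finset.insert_subset heF hAF, ?_, fun e he e' he' hle => ?_⟩
    · rw [Finset.card_insert_of_notMem heA, hcard]
    by_cases hA : e' ∈ A
    · exact Finset.mem_insert_of_mem hA
    rcases Finset.mem_insert.1 he with rfl | he
    · rw [hρ (le_antisymm (hmax e' (Finset.mem_sdiff.2 ⟨he', hA⟩)) hle)]
      exact Finset.mem_insert_self e A
    · exact absurd (hupper e he e' he' hle) hA

variable [Fintype E] [DecidableEq L]

/-- The size of a fibre. -/
def fiberCard (β : E → L) (l : L) : ℕ := (Finset.univ.filter fun e => β e = l).card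

/-- The numbers of elements of a set in the fibres. -/
def fiberCount (β : E → L) (A : Finset E) : ∀ l, Fin (fiberCard β l + 1) := fun l =>
  ⟨(A.filter fun e => β e = l).card,
    Nat.lt_succ_of_le (Finset.card_le_card (Finset.filter_subset_filter _ A.subset_univ))⟩

theorem sum_fiberCard [Fintype L] (β : E → L) : ∑ l, fiberCard β l = Fintype.card E :=
  (Finset.card_eq_sum_card_fiberwise fun e _ => Finset.mem_coe.2 (Finset.mem_univ (β e))).symm

theorem fiberCount_empty : fiberCount β (∅ : Finset E) = ⊥ :=
  funext fun l => Fin.ext (congrArg Finset.card (Finset.filter_empty fun e => β e = l))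

theorem fiberCount_univ : fiberCount β (Finset.univ : Finset E) = ⊤ := rfl

theorem fiberCount_le_iff {A B : Finset E} (hA : IsFiberwiseUpper β ρ A)
    (hB : IsFiberwiseUpper β ρ B) : fiberCount β A ≤ fiberCount β B ↔ A ⊆ B := by
  refine ⟨fun h => ?_, fun h l => Finset.card_le_card (Finset.filter_subset_filter _ h)⟩
  by_contra hsub
  obtain ⟨e, heA, heB⟩ := Finset.not_subset.1 hsub
  have hle : (A.filter fun e' => β e' = β e).card ≤ (B.filter fun e' => β e' = β e).card :=
    h (β e)
  refine hle.not_gt (Finset.card_lt_card ((Finset.ssubset_iff_of_subset ?_).2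
    ⟨e, Finset.mem_filter.2 ⟨heA, rfl⟩, fun he => heB (Finset.mem_filter.1 he).1⟩))
  refine fun e' he' => Finset.mem_filter.2 ?_
  obtain ⟨he'B, hβ⟩ := Finset.mem_filter.1 he'
  refine ⟨(le_total (ρ e) (ρ e')).elim (fun hle => hA e e' hβ.symm hle heA) fun hle => ?_, hβ⟩
  exact absurd (hB e' e hβ hle he'B) heB

theorem fiberCount_injOn : Set.InjOn (fiberCount β) {A | IsFiberwiseUpper β ρ A} :=
  fun _ hA _ hB h =>
    ((fiberCount_le_iff hA hB).1 h.le).antisymm ((fiberCount_le_iff hB hA).1 h.ge)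

theorem exists_fiberCount_eq (hρ : Function.Injective ρ) (y : ∀ l, Fin (fiberCard β l + 1)) :
    ∃ A, IsFiberwiseUpper β ρ A ∧ fiberCount β A = y := by
  classical
  choose B hBF hcard hupper using fun l =>
    exists_upper_subset_card_eq hρ (Finset.univ.filter fun e => β e = l) (Fin.is_le (y l))
  have hβ : ∀ {l e}, e ∈ B l → β e = l := fun h => (Finset.mem_filter.1 (hBF _ h)).2
  refine ⟨Finset.univ.filter fun e => e ∈ B (β e), fun e e' h hle he => ?_, ?_⟩
  · rw [Finset.mem_filter_univ] at he ⊢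
    rw [← h]
    exact hupper _ e he e' (Finset.mem_filter.2 ⟨Finset.mem_univ _, h.symm⟩) hle
  · refine funext fun l => Fin.ext ((congrArg Finset.card ?_).trans (hcard l))
    ext e
    rw [Finset.mem_filter, Finset.mem_filter_univ]
    exact ⟨fun h => h.2 ▸ h.1, fun h => ⟨(hβ h).symm ▸ h, hβ h⟩⟩

/-- The correspondence between the proper fibrewise up-sets and the elements of a product of chains
other than its maximum. -/
noncomputable def fiberCountEquiv (β : E → L) (hρ : Function.Injective ρ) :
    {A // IsFiberwiseUpper β ρ A ∧ A ≠ Finset.univ} ≃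
      {y : ∀ l, Fin (fiberCard β l + 1) | y ≠ ⊤} :=
  Equiv.ofBijective (fun A => ⟨fiberCount β A.1, fun h =>
      A.2.2 (fiberCount_injOn A.2.1 isFiberwiseUpper_univ (h.trans fiberCount_univ.symm))⟩)
    ⟨fun A B h => Subtype.ext (fiberCount_injOn A.2.1 B.2.1 (congrArg Subtype.val h)), by
      rintro ⟨y, hy⟩
      obtain ⟨A, hA, rfl⟩ := exists_fiberCount_eq hρ y
      exact ⟨⟨A, hA, fun h => hy (h ▸ fiberCount_univ)⟩, rfl⟩⟩

end Fibers

section Lifts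

variable {n q : ℕ} {x : Fin (n + 1) → ℤ}

/-- A lift of a vertex of the edgewise subdivision, in coordinates that are unique up to adding a
constant: the differences `u i - u 0` are the coordinates of the vertex. -/
def IsLift (q : ℕ) (u : Fin (n + 1) → ℤ) : Prop := Monotone u ∧ u (Fin.last n) ≤ u 0 + q

/-- The vertex represented by a lift. -/
def proj (u : Fin (n + 1) → ℤ) : Fin n → ℤ := fun i => u i.succ - u 0

theorem IsLift.zero_le (hx : IsLift q x) (i : Fin (n + 1)) : x 0 ≤ x i := hx.1 (Fin.zero_le i)

theorem IsLift.le_add (hx : IsLift q x) (i : Fin (n + 1)) : x i ≤ x 0 + q :=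
  (hx.1 (Fin.le_last i)).trans hx.2

theorem isLift_iff_proj : IsLift q x ↔ Monotone (proj x) ∧ ∀ i, 0 ≤ proj x i ∧ proj x i ≤ q := by
  refine ⟨fun hx => ⟨fun i j hij => sub_le_sub_right (hx.1 (Fin.succ_le_succ_iff.2 hij)) _,
    fun i => ⟨sub_nonneg.2 (hx.zero_le _), sub_le_iff_le_add'.2 (hx.le_add _)⟩⟩, ?_⟩
  rintro ⟨hmono, hbound⟩
  have hle : ∀ i : Fin (n + 1), x 0 ≤ x i ∧ x i ≤ x 0 + q := by
    refine Fin.cases ⟨le_rfl, by omega⟩ fun i => ?_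
    exact ⟨sub_nonneg.1 (hbound i).1, sub_le_iff_le_add'.1 (hbound i).2⟩
  refine ⟨fun i j hij => ?_, (hle _).2⟩
  induction i using Fin.cases with
  | zero => exact (hle j).1
  | succ i =>
    obtain ⟨j, rfl⟩ := Fin.exists_succ_eq.2 (((Fin.succ_pos i).trans_le hij).ne')
    exact sub_le_sub_iff_right (x 0) |>.1 (hmono (Fin.succ_le_succ_iff.1 hij))

theorem proj_mem_vertices_iff {k : ℕ} {x : Fin (k - 1 + 1) → ℤ} :
    proj x ∈ vertices k q ↔ IsLift q x :=
  isLift_iff_proj.symm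

theorem exists_isLift {k : ℕ} {b : Fin (k - 1) → ℤ} (hb : b ∈ vertices k q) :
    ∃ x : Fin (k - 1 + 1) → ℤ, IsLift q x ∧ proj x = b := by
  have h : proj (Fin.cons 0 b : Fin (k - 1 + 1) → ℤ) = b := funext fun i => by simp [proj]
  exact ⟨Fin.cons 0 b, proj_mem_vertices_iff.1 (h.symm ▸ hb), h⟩

/-- The residue of a coordinate of a lift. -/
def label (q : ℕ) (x : Fin (n + 1) → ℤ) (i : Fin (n + 1)) : ZMod q := (x i : ZMod q)

/-- Among coordinates of equal residue, those of larger position have to be increased first. -/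
def position (q : ℕ) (x : Fin (n + 1) → ℤ) (i : Fin (n + 1)) : ℤ :=
  if x i = x 0 + q then (i : ℤ) - (n + 1) else i

theorem position_injective (q : ℕ) (x : Fin (n + 1) → ℤ) : Function.Injective (position q x) := by
  intro i j h
  have := i.2
  have := j.2
  simp only [position] at h
  exact Fin.ext (by split_ifs at h <;> omega)

theorem IsLift.label_eq_iff (hx : IsLift q x) (i j : Fin (n + 1)) :
    label q x i = label q x j ↔ x i = x j ∨ (x i = x 0 ∧ x j = x 0 + q) ∨
      (x j = x 0 ∧ x i = x 0 + q) := by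
  have hi := hx.zero_le i
  have hj := hx.zero_le j
  have hi' := hx.le_add i
  have hj' := hx.le_add j
  rw [label, label, ZMod.intCast_eq_intCast_iff_dvd_sub]
  constructor
  · intro h
    rcases lt_trichotomy (x j - x i) 0 with hneg | hzero | hpos
    · have := Int.le_of_dvd (by omega) ((dvd_neg (a := (q : ℤ))).2 h)
      omega
    · omega
    · have := Int.le_of_dvd hpos h
      omega
  · rintro (h | ⟨h, h'⟩ | ⟨h, h'⟩)
    · simp [h]
    · exact ⟨1, by omega⟩
    · exact ⟨-1, by omega⟩

theorem exists_isLift_fiberCard_eq [NeZero q] (d : ZMod q → ℕ) (hd : ∑ l, d l = n + 1) :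
    ∃ x : Fin (n + 1) → ℤ, IsLift q x ∧ fiberCard (label q x) = d := by
  let e := Fintype.equivOfCardEq (α := Fin (n + 1)) (β := Σ l, Fin (d l)) (by simp [hd])
  let g : Fin (n + 1) → ℕ := fun i => (e i).1.val
  let π := Tuple.sort g
  refine ⟨fun i => (g (π i) : ℤ), ⟨fun i j hij => ?_, ?_⟩, funext fun l => ?_⟩
  · exact Int.ofNat_le.2 (Tuple.monotone_sort g hij)
  · have := ZMod.val_lt (e (π (Fin.last n))).1
    simp only [g]
    omega
  · have hlabel : ∀ i, label q (fun i => (g (π i) : ℤ)) i = (e (π i)).1 := fun i => by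
      simp [label, g]
    let f : {i // (e (π i)).1 = l} ≃ Fin (d l) :=
      ((π.trans e).subtypeEquiv fun i => Iff.rfl).trans (Equiv.sigmaSubtype l)
    simp only [fiberCard, hlabel]
    rw [← Fintype.card_subtype, Fintype.card_congr f, Fintype.card_fin]

end Lifts

section Raise

variable {n q : ℕ} {x : Fin (n + 1) → ℤ} {A B : Finset (Fin (n + 1))}

/-- The point `x` with the coordinates in `A` increased by one. -/
def raise (x : Fin (n + 1) → ℤ) (A : Finset (Fin (n + 1))) : Fin (n + 1) → ℤ :=
  fun i => x i + if i ∈ A then 1 else 0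

theorem raise_empty : raise x ∅ = x :=
  funext fun i => by simp [raise]

theorem raise_of_mem {i : Fin (n + 1)} (h : i ∈ A) : raise x A i = x i + 1 := by
  simp [raise, h]

theorem raise_of_notMem {i : Fin (n + 1)} (h : i ∉ A) : raise x A i = x i := by
  simp [raise, h]

theorem le_raise (x : Fin (n + 1) → ℤ) (A : Finset (Fin (n + 1))) (i : Fin (n + 1)) :
    x i ≤ raise x A i := by
  simp only [raise]
  split_ifs <;> omega

theorem raise_le (x : Fin (n + 1) → ℤ) (A : Finset (Fin (n + 1))) (i : Fin (n + 1)) :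
    raise x A i ≤ x i + 1 := by
  simp only [raise]
  split_ifs <;> omega

theorem IsLift.eq_or_eq_of_position_le [NeZero q] (hx : IsLift q x) {i j : Fin (n + 1)}
    (hl : label q x i = label q x j) (hp : position q x i ≤ position q x j) :
    (x i = x j ∧ i ≤ j) ∨ (x j = x 0 ∧ x i = x 0 + q) := by
  have hq : 0 < q := NeZero.pos q
  have := i.2
  have := j.2
  simp only [position] at hp
  rw [Fin.le_def]
  rcases (hx.label_eq_iff i j).1 hl with h | h | h <;> split_ifs at hp <;> omega

theorem IsLift.isFiberwiseUpper_of_raise [NeZero q] (hx : IsLift q x)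
    (h : IsLift q (raise x A)) : IsFiberwiseUpper (label q x) (position q x) A := by
  intro i j hl hp hi
  by_contra hj
  have hri := raise_of_mem (x := x) hi
  have hrj := raise_of_notMem (x := x) hj
  rcases hx.eq_or_eq_of_position_le hl hp with ⟨heq, hij⟩ | ⟨heq, heq'⟩
  · have := h.1 hij
    omega
  · have := h.zero_le j
    have := h.le_add i
    omega

theorem IsLift.raise_of_isFiberwiseUpper [NeZero q] (hx : IsLift q x)
    (h : IsFiberwiseUpper (label q x) (position q x) A) : IsLift q (raise x A) := by
  have hq : 0 < q := NeZero.pos q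
  have hle : ∀ i j, label q x i = label q x j → position q x i ≤ position q x j →
      raise x A i - x i ≤ raise x A j - x j := fun i j hl hp => by
    by_cases hi : i ∈ A
    · rw [raise_of_mem hi, raise_of_mem (h i j hl hp hi)]
      omega
    · have := raise_of_notMem (x := x) hi
      have := le_raise x A j
      omega
  refine ⟨fun i j hij => ?_, ?_⟩
  · have hi := raise_le x A i
    have hj := le_raise x A j
    rcases (hx.1 hij).lt_or_eq with hlt | heq
    · omega
    · have := hle i j ((hx.label_eq_iff i j).2 (Or.inl heq)) <| by
        have := Fin.le_def.1 hij
        simp only [position, heq]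
        split_ifs <;> omega
      omega
  · have hlast := raise_le x A (Fin.last n)
    have hzero := le_raise x A 0
    rcases hx.2.lt_or_eq with hlt | heq
    · omega
    · have := hle (Fin.last n) 0 ((hx.label_eq_iff _ _).2 (Or.inr (Or.inr ⟨rfl, heq⟩))) <| by
        simp only [position, if_pos heq, Fin.val_last, Fin.val_zero]
        split_ifs <;> omega
      omega

theorem proj_raise (x : Fin (n + 1) → ℤ) (A : Finset (Fin (n + 1))) (i : Fin n) :
    proj (raise x A) i = proj x i + (if i.succ ∈ A then 1 else 0) - if 0 ∈ A then 1 else 0 := by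
  simp only [proj, raise]
  ring

theorem eq_univ_iff_succ : A = Finset.univ ↔ 0 ∈ A ∧ ∀ i : Fin n, i.succ ∈ A := by
  rw [Finset.eq_univ_iff_forall]
  exact Fin.forall_fin_succ

theorem subset_iff_succ : A ⊆ B ↔ (0 ∈ A → 0 ∈ B) ∧ ∀ i : Fin n, i.succ ∈ A → i.succ ∈ B :=
  Fin.forall_fin_succ (P := fun i => i ∈ A → i ∈ B)

theorem proj_raise_le_iff (hB : B ≠ Finset.univ) :
    proj (raise x A) ≤ proj (raise x B) ∧ proj (raise x B) ≤ proj (raise x A) + 1 ↔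
      (A ⊆ B ∧ (0 ∈ B → 0 ∈ A)) ∨ (B ⊆ A ∧ 0 ∈ A ∧ 0 ∉ B) := by
  have hB' := mt eq_univ_iff_succ.2 hB
  simp only [Pi.le_def, Pi.add_apply, Pi.one_apply, proj_raise, subset_iff_succ, ← forall_and]
  by_cases hA0 : 0 ∈ A <;> by_cases hB0 : 0 ∈ B <;> grind

theorem near_proj_raise_iff (hA : A ≠ Finset.univ) (hB : B ≠ Finset.univ) :
    Near (proj (raise x A)) (proj (raise x B)) ↔ A ⊆ B ∨ B ⊆ A := by
  rw [Near, proj_raise_le_iff hA, proj_raise_le_iff hB]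
  have hAB : A ⊆ B → 0 ∈ A → 0 ∈ B := fun h => @h 0
  have hBA : B ⊆ A → 0 ∈ B → 0 ∈ A := fun h => @h 0
  tauto

theorem near_proj_raise (x : Fin (n + 1) → ℤ) (hA : A ≠ Finset.univ) :
    Near (proj x) (proj (raise x A)) := by
  have h := (near_proj_raise_iff (x := x) Finset.univ_nonempty.ne_empty.symm hA).2
    (Or.inl A.empty_subset)
  rwa [raise_empty] at h

theorem proj_raise_injOn (x : Fin (n + 1) → ℤ) :
    Set.InjOn (fun A => proj (raise x A)) {A | A ≠ Finset.univ} := by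
  intro A hA B hB h
  have h : proj (raise x A) = proj (raise x B) := h
  have hAB := (proj_raise_le_iff (x := x) hB).1 ⟨h.le, by rw [h]; exact fun i => by simp⟩
  have hBA := (proj_raise_le_iff (x := x) hA).1 ⟨h.ge, by rw [h]; exact fun i => by simp⟩
  exact Finset.Subset.antisymm_iff.2 (by tauto)

theorem exists_proj_raise_eq {z : Fin n → ℤ} (hz : Near (proj x) z) :
    ∃ A, A ≠ Finset.univ ∧ proj (raise x A) = z := by
  let S : Finset (Fin (n + 1)) := (Finset.univ.filter fun i => z i ≠ proj x i).map (Fin.succEmb n)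
  have hzero : 0 ∉ S := by simp [S]
  have hsucc : ∀ i : Fin n, i.succ ∈ S ↔ z i ≠ proj x i := by simp [S]
  rcases em (proj x ≤ z) with hle | hle
  · have hle' : z ≤ proj x + 1 := hz.elim And.right fun h => h.1.trans fun i => by simp
    refine ⟨S, fun hS => hzero (eq_univ_iff_succ.1 hS).1, funext fun i => ?_⟩
    have hi : proj x i ≤ z i := hle i
    have hi' : z i ≤ proj x i + 1 := hle' i
    rw [proj_raise, if_neg hzero]
    split_ifs with h <;> rw [hsucc] at h <;> omega
  · obtain ⟨hge, hge'⟩ := hz.resolve_left fun h => hle h.1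
    refine ⟨Sᶜ, fun hS => hle fun i => ?_, funext fun i => ?_⟩
    · have := (eq_univ_iff_succ.1 hS).2 i
      rw [Finset.mem_compl, hsucc, not_not] at this
      exact this.ge
    · have hi : z i ≤ proj x i := hge i
      have hi' : proj x i ≤ z i + 1 := hge' i
      rw [proj_raise, if_pos (Finset.mem_compl.2 hzero)]
      split_ifs with h <;> rw [Finset.mem_compl, hsucc] at h <;> omega

end Raise

section Star

variable {k q : ℕ} [NeZero q] {x : Fin (k - 1 + 1) → ℤ}

/-- The correspondence between the proper fibrewise up-sets of coordinates and the vertices near a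
given vertex, which maps `A` to the point with the coordinates in `A` increased. -/
noncomputable def raiseEquiv (hx : IsLift q x) :
    {A // IsFiberwiseUpper (label q x) (position q x) A ∧ A ≠ Finset.univ} ≃
      {z | z ∈ vertices k q ∧ ¬(farGraph _).Adj (proj x) z} :=
  Equiv.ofBijective (fun A => ⟨proj (raise x A.1),
      proj_mem_vertices_iff.2 (hx.raise_of_isFiberwiseUpper A.2.1),
      not_farGraph_adj.2 (near_proj_raise x A.2.2)⟩)
    ⟨fun A B h => Subtype.ext (proj_raise_injOn x A.2.2 B.2.2 (congrArg Subtype.val h)), by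
      rintro ⟨z, hz, hnear⟩
      obtain ⟨A, hA, rfl⟩ := exists_proj_raise_eq (not_farGraph_adj.1 hnear)
      exact ⟨⟨A, hx.isFiberwiseUpper_of_raise (proj_mem_vertices_iff.1 hz), hA⟩, rfl⟩⟩

/-- The vertices near a given vertex, as elements of a product of chains. -/
noncomputable def starIso (hx : IsLift q x) :
    (incompGraph (∀ l, Fin (fiberCard (label q x) l + 1))).induce {y | y ≠ ⊤} ≃g
      (farGraph _).induce {z | z ∈ vertices k q ∧ ¬(farGraph _).Adj (proj x) z} :=
  RelIso.symm <| .mk ((raiseEquiv hx).symm.trans (fiberCountEquiv _ (position_injective q x))) <| by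
    intro z w
    obtain ⟨A, rfl⟩ := (raiseEquiv hx).surjective z
    obtain ⟨B, rfl⟩ := (raiseEquiv hx).surjective w
    rw [Equiv.trans_apply, Equiv.trans_apply, Equiv.symm_apply_apply, Equiv.symm_apply_apply]
    refine not_iff_not.1 ((not_incompGraph_adj.trans ?_).trans not_farGraph_adj.symm)
    exact (or_congr (fiberCount_le_iff A.2.1 B.2.1) (fiberCount_le_iff B.2.1 A.2.1)).trans
      (near_proj_raise_iff A.2.2 B.2.2).symm

theorem starIso_bot (hx : IsLift q x) (h : (⊥ : ∀ l, Fin (fiberCard (label q x) l + 1)) ≠ ⊤) :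
    (starIso hx ⟨⊥, h⟩ : Fin (k - 1) → ℤ) = proj x := by
  let A : {A // IsFiberwiseUpper (label q x) (position q x) A ∧ A ≠ Finset.univ} :=
    ⟨∅, isFiberwiseUpper_empty, Finset.univ_nonempty.ne_empty.symm⟩
  have hA : ⟨⊥, h⟩ = fiberCountEquiv _ (position_injective q x) A :=
    Subtype.ext fiberCount_empty.symm
  have : starIso hx ⟨⊥, h⟩ = raiseEquiv hx A :=
    congrArg (raiseEquiv hx) ((Equiv.symm_apply_eq _).2 hA)
  rw [this]
  exact congrArg proj raise_empty

end Star

section LinkOfChain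

variable {V P : Type*} [PartialOrder P] [BoundedOrder P] {m : ℕ} {x : Fin (m + 2) → P}

theorem exists_strictMono_enumeration {C : Finset P} (hC : IsChain (· ≤ ·) (C : Set P))
    (hbot : ⊥ ∈ C) (htop : ⊤ ∈ C) (hcard : C.card = m + 2) :
    ∃ x : Fin (m + 2) → P, StrictMono x ∧ x 0 = ⊥ ∧ x (Fin.last _) = ⊤ ∧
      ∀ y, y ∈ C ↔ ∃ j, x j = y := by
  obtain ⟨x, hx, hmap⟩ := exists_monotone_map_univ_eq hcard fun a ha b hb =>
    not_incompGraph_adj.2 (hC.total ha hb)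
  have hmem : ∀ y, y ∈ C ↔ ∃ j, x j = y := fun y => by
    rw [← Finset.mem_val, ← hmap, Multiset.mem_map]
    simp
  have hinj : Function.Injective x := fun i j h =>
    Multiset.inj_on_of_nodup_map (hmap ▸ C.nodup) i (Finset.mem_univ_val i) j
      (Finset.mem_univ_val j) h
  refine ⟨x, hx.strictMono_of_injective hinj, ?_, ?_, hmem⟩
  · obtain ⟨j, hj⟩ := (hmem ⊥).1 hbot
    exact le_bot_iff.1 ((hx (Fin.zero_le j)).trans_eq hj)
  · obtain ⟨j, hj⟩ := (hmem ⊤).1 htop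
    exact top_le_iff.1 (hj.ge.trans (hx (Fin.le_last j)))

variable {G : SimpleGraph V} {A : Set V} {v : V} {σ : Finset V}

/-- The vertices of a face are the images of the elements of a chain other than the maximum. -/
def IsChainImage (φ : (incompGraph P).induce {y | y ≠ ⊤} ≃g G.induce {z | z ∈ A ∧ ¬G.Adj v z})
    (x : Fin (m + 2) → P) (σ : Finset V) : Prop :=
  ∀ w, w ∈ σ ↔ ∃ j h, φ ⟨x j, h⟩ = w

variable {φ : (incompGraph P).induce {y | y ≠ ⊤} ≃g G.induce {z | z ∈ A ∧ ¬G.Adj v z}}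

theorem exists_isChain_of_mem_faces (hP : (⊥ : P) ≠ ⊤) (hφ : φ ⟨⊥, hP⟩ = v)
    (hσ : σ ∈ (indepComplex G A).faces) (hv : v ∈ σ) :
    ∃ C : Finset P, IsChain (· ≤ ·) (C : Set P) ∧ ⊥ ∈ C ∧ ⊤ ∈ C ∧ C.card = σ.card + 1 ∧
      ∀ w, w ∈ σ ↔ ∃ y ∈ C, ∃ h, φ ⟨y, h⟩ = w := by
  classical
  have hnear : ∀ w ∈ σ, w ∈ A ∧ ¬G.Adj v w := fun w hw =>
    ⟨hσ.2.1 hw, fun h => hσ.2.2 hv hw h.ne h⟩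
  let g : σ → {y : P | y ≠ ⊤} := fun w => φ.symm ⟨w, hnear w w.2⟩
  have hφg : ∀ w, φ (g w) = w.1 := fun w => congrArg Subtype.val (φ.apply_symm_apply _)
  have hg : Function.Injective fun w => (g w).1 := fun w w' h => Subtype.ext <| by
    rw [← hφg, ← hφg, Subtype.ext h]
  have hbot : g ⟨v, hv⟩ = ⟨⊥, hP⟩ := φ.injective (Subtype.ext ((hφg _).trans hφ.symm))
  let S : Finset P := Finset.univ.map ⟨_, hg⟩
  have hS : ∀ {y}, y ∈ S ↔ ∃ w, (g w).1 = y := by simp [S]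
  have htop : ⊤ ∉ S := fun h => (hS.1 h).elim fun w hw => (g w).2 hw
  have hchain : IsChain (· ≤ ·) (S : Set P) := by
    intro a ha b hb hab
    obtain ⟨⟨w, rfl⟩, ⟨w', rfl⟩⟩ := And.intro (hS.1 ha) (hS.1 hb)
    refine not_incompGraph_adj.1 fun h => ?_
    have hadj : G.Adj (φ (g w)) (φ (g w')) := φ.map_adj_iff.2 h
    rw [hφg, hφg] at hadj
    exact hσ.2.2 w.2 w'.2 hadj.ne hadj
  refine ⟨insert ⊤ S, ?_, Finset.mem_insert_of_mem (hS.2 ⟨_, congrArg _ hbot⟩),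
    Finset.mem_insert_self _ _, ?_, fun w => ⟨fun hw => ?_, ?_⟩⟩
  · rw [Finset.coe_insert]
    exact hchain.insert fun b _ _ => Or.inr le_top
  · rw [Finset.card_insert_of_notMem htop, Finset.card_map, Finset.card_univ, Fintype.card_coe]
  · exact ⟨_, Finset.mem_insert_of_mem (hS.2 ⟨⟨w, hw⟩, rfl⟩), (g ⟨w, hw⟩).2, hφg ⟨w, hw⟩⟩
  · rintro ⟨y, hy, h, rfl⟩
    obtain ⟨w, rfl⟩ := hS.1 (Finset.mem_of_mem_insert_of_ne hy h)
    exact (hφg w).symm ▸ w.2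

theorem exists_isChainImage (hP : (⊥ : P) ≠ ⊤) (hφ : φ ⟨⊥, hP⟩ = v)
    (hσ : σ ∈ (indepComplex G A).faces) (hv : v ∈ σ) (hcard : σ.card = m + 1) :
    ∃ x : Fin (m + 2) → P, StrictMono x ∧ x 0 = ⊥ ∧ x (Fin.last _) = ⊤ ∧
      IsChainImage φ x σ := by
  obtain ⟨C, hC, hbot, htop, hCcard, hmem⟩ := exists_isChain_of_mem_faces hP hφ hσ hv
  obtain ⟨x, hx, h0, h1, hxC⟩ :=
    exists_strictMono_enumeration hC hbot htop (hCcard.trans (congrArg (· + 1) hcard))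
  refine ⟨x, hx, h0, h1, fun w => (hmem w).trans ⟨?_, ?_⟩⟩
  · rintro ⟨y, hy, h, rfl⟩
    obtain ⟨j, rfl⟩ := (hxC y).1 hy
    exact ⟨j, h, rfl⟩
  · rintro ⟨j, h, rfl⟩
    exact ⟨x j, (hxC _).2 ⟨j, rfl⟩, h, rfl⟩

theorem exists_mem_faces_isChainImage (hx : StrictMono x) (h1 : x (Fin.last _) = ⊤) :
    ∃ σ ∈ (indepComplex G A).faces, σ.card = m + 1 ∧ IsChainImage φ x σ := by
  have hne : ∀ j, x j ≠ ⊤ ↔ j ≠ Fin.last _ := fun j => by rw [← h1, hx.injective.ne_iff]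
  let f : Fin (m + 1) ↪ V := ⟨fun j => φ ⟨x j.castSucc, (hne _).2 (Fin.castSucc_lt_last j).ne⟩,
    fun i j h => Fin.castSucc_injective _ <| hx.injective <|
      congrArg Subtype.val (φ.injective (Subtype.ext h))⟩
  refine ⟨Finset.univ.map f, ⟨?_, ?_, ?_⟩, ?_, fun w => ?_⟩
  · exact Finset.univ_nonempty.map
  · intro w hw
    obtain ⟨j, -, rfl⟩ := Finset.mem_map.1 hw
    exact (φ ⟨x j.castSucc, _⟩).2.1
  · intro w hw w' hw' _ h
    obtain ⟨i, -, rfl⟩ := Finset.mem_map.1 hw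
    obtain ⟨j, -, rfl⟩ := Finset.mem_map.1 hw'
    refine not_incompGraph_adj.2 ?_ (φ.map_adj_iff.1 h)
    exact (le_total i j).imp (fun h => hx.monotone h) fun h => hx.monotone h
  · rw [Finset.card_map, Finset.card_fin]
  · rw [Finset.mem_map]
    constructor
    · rintro ⟨j, -, rfl⟩
      exact ⟨_, _, rfl⟩
    · rintro ⟨j, h, rfl⟩
      obtain ⟨i, rfl⟩ := Fin.exists_castSucc_eq.2 ((hne j).1 h)
      exact ⟨i, Finset.mem_univ i, rfl⟩

theorem IsChainImage.nonempty_link_iso (hσ : IsChainImage φ x σ) (hv : v ∈ σ)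
    (h1 : x (Fin.last _) = ⊤) :
    Nonempty ((incompGraph P).induce {y | ∀ j, ¬(incompGraph P).Adj (x j) y ∧ y ≠ x j} ≃g
      G.induce {w | w ∈ A ∧ w ∉ σ ∧ ∀ u ∈ σ, ¬G.Adj u w}) := by
  have hne : ∀ {y}, (∀ j, ¬(incompGraph P).Adj (x j) y ∧ y ≠ x j) → y ≠ ⊤ :=
    fun hy => h1 ▸ (hy (Fin.last _)).2
  have hmem : ∀ {y} (h : y ≠ ⊤), (∀ j, ¬(incompGraph P).Adj (x j) y ∧ y ≠ x j) ↔
      (φ ⟨y, h⟩ : V) ∉ σ ∧ ∀ u ∈ σ, ¬G.Adj u (φ ⟨y, h⟩) := fun {y} h => by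
    refine ⟨fun hy => ⟨fun hyσ => ?_, fun u hu hadj => ?_⟩, fun hy j => ⟨fun hadj => ?_, ?_⟩⟩
    · obtain ⟨j, hj, he⟩ := (hσ _).1 hyσ
      exact (hy j).2 (congrArg Subtype.val (φ.injective (Subtype.ext he))).symm
    · obtain ⟨j, hj, rfl⟩ := (hσ u).1 hu
      exact (hy j).1 (φ.map_adj_iff.1 hadj)
    · have hj : x j ≠ ⊤ := fun hj => not_incompGraph_adj.2 (Or.inr (hj ▸ le_top)) hadj
      exact hy.2 _ ((hσ _).2 ⟨j, hj, rfl⟩) (φ.map_adj_iff.2 hadj)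
    · rintro rfl
      exact hy.1 ((hσ _).2 ⟨j, h, rfl⟩)
  refine ⟨⟨Equiv.ofBijective
    (fun y => ⟨φ ⟨y, hne y.2⟩, (φ ⟨y, hne y.2⟩).2.1, (hmem _).1 y.2⟩) ⟨fun y z h => ?_, ?_⟩,
    φ.map_adj_iff⟩⟩
  · have hφ : φ ⟨y, hne y.2⟩ = φ ⟨z, hne z.2⟩ := Subtype.ext (Subtype.mk.inj h)
    exact Subtype.ext (Subtype.mk.inj (φ.injective hφ))
  · rintro ⟨w, hw, hwσ⟩
    obtain ⟨⟨y, h⟩, hy⟩ := φ.surjective ⟨w, hw, hwσ.2 v hv⟩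
    obtain rfl : (φ ⟨y, h⟩ : V) = w := congrArg Subtype.val hy
    exact ⟨⟨y, (hmem h).2 hwσ⟩, rfl⟩

end LinkOfChain

section LinkTypes

variable {k q m : ℕ} {x : Fin (k - 1 + 1) → ℤ}

theorem sum_fiberCard_label [NeZero q] (hk : 1 ≤ k) (x : Fin (k - 1 + 1) → ℤ) :
    ∑ l, fiberCard (label q x) l = k := by
  rw [sum_fiberCard, Fintype.card_fin, Nat.sub_add_cancel hk]

theorem combType_link_edgewise [NeZero q] (hx : IsLift q x) {σ : Finset (Fin (k - 1) → ℤ)}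
    {y : Fin (m + 2) → ∀ l, Fin (fiberCard (label q x) l + 1)} (hσ : σ ∈ (edgewise k q).faces)
    (hxσ : proj x ∈ σ) (hy : StrictMono y) (h0 : y 0 = ⊥) (h1 : y (Fin.last _) = ⊤)
    (hyσ : IsChainImage (starIso hx) y σ) :
    combType (link (edgewise k q) σ) = joinType (Finset.univ.val.map (gapParts y)) := by
  rw [edgewise_eq_indepComplex k (NeZero.pos q)] at hσ ⊢
  rw [link_indepComplex hσ, ← combType_joinGraph, combType_indepComplex_eq_iff]
  obtain ⟨e⟩ := nonempty_induce_iso_joinGraph_gapParts hy h0 h1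
  obtain ⟨f⟩ := hyσ.nonempty_link_iso hxσ h1
  exact ⟨(f.symm.trans e).trans (SimpleGraph.induceUnivIso _).symm⟩

theorem bot_ne_top_of_sum_pos {ι : Type*} [Fintype ι] {d : ι → ℕ} (hd : 0 < ∑ i, d i) :
    (⊥ : ∀ i, Fin (d i + 1)) ≠ ⊤ := fun h => by
  have := congrArg rank h
  rw [rank_bot, rank_top] at this
  omega

theorem exists_gapParts_of_mem_linkTypes [NeZero q] (hk : 1 ≤ k) {c : CombType}
    (hc : c ∈ linkTypes k q m) :
    ∃ s : Fin (m + 1) → Multiset ℕ, (∀ j, 0 ∉ s j ∧ s j ≠ 0) ∧ ∑ j, (s j).sum = k ∧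
      c = joinType (Finset.univ.val.map s) := by
  obtain ⟨σ, hσ, hcard, rfl⟩ := hc
  have hσ' := hσ
  rw [edgewise_eq_indepComplex k (NeZero.pos q)] at hσ'
  obtain ⟨v, hv⟩ := hσ'.1
  obtain ⟨x, hx, rfl⟩ := exists_isLift (hσ'.2.1 hv)
  have hsum := sum_fiberCard_label hk x (q := q)
  obtain ⟨y, hy, h0, h1, hyσ⟩ := exists_isChainImage
    (bot_ne_top_of_sum_pos (hk.trans_eq hsum.symm)) (starIso_bot hx _) hσ' hv hcard
  exact ⟨gapParts y, fun j => ⟨zero_notMem_parts _, gapParts_ne_zero hy j⟩,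
    (sum_sum_gapParts hy.monotone h0 h1).trans hsum, combType_link_edgewise hx hσ hv hy h0 h1 hyσ⟩

theorem card_add_le_sum_sum {s : Fin (m + 1) → Multiset ℕ} (hs : ∀ j, 0 ∉ s j ∧ s j ≠ 0)
    (j : Fin (m + 1)) : (s j).card + m ≤ ∑ j, (s j).sum := by
  rw [Fin.sum_univ_succAbove _ j]
  refine add_le_add (card_le_sum (hs j).1) ?_
  simpa using Finset.card_nsmul_le_sum Finset.univ (fun i => (s (j.succAbove i)).sum) 1 fun i _ =>
    (Multiset.card_pos.2 (hs _).2).trans_le (card_le_sum (hs _).1)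

theorem joinType_mem_linkTypes [NeZero q] (hk : 1 ≤ k) (hq : k ≤ q + m)
    {s : Fin (m + 1) → Multiset ℕ} (hs : ∀ j, 0 ∉ s j ∧ s j ≠ 0) (hsum : ∑ j, (s j).sum = k) :
    joinType (Finset.univ.val.map s) ∈ linkTypes k q m := by
  have hcard : ∀ j, (s j).card ≤ Fintype.card (ZMod q) := fun j => by
    have := card_add_le_sum_sum hs j
    rw [ZMod.card]
    omega
  obtain ⟨d, y, hy, h0, h1, rfl⟩ := exists_chain_gapParts_eq (ZMod q) s (fun j => (hs j).1)
    (fun j => (hs j).2) hcard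
  rw [sum_sum_gapParts hy.monotone h0 h1, ← Nat.sub_add_cancel hk] at hsum
  obtain ⟨x, hx, rfl⟩ := exists_isLift_fiberCard_eq d hsum
  have hP := bot_ne_top_of_sum_pos (Nat.succ_pos _ |>.trans_eq hsum.symm)
  obtain ⟨σ, hσ, hσcard, hyσ⟩ := exists_mem_faces_isChainImage (φ := starIso hx) hy h1
  have hxσ : proj x ∈ σ := (hyσ _).2 ⟨0, h0 ▸ hP, by simp only [h0, starIso_bot]⟩
  rw [← edgewise_eq_indepComplex k (NeZero.pos q)] at hσ
  exact ⟨σ, hσ, hσcard, (combType_link_edgewise hx hσ hxσ hy h0 h1 hyσ).symm⟩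

theorem exists_family_eq {α : Type*} {N : Multiset α} {r : ℕ} (h : N.card = r) :
    ∃ s : Fin r → α, Finset.univ.val.map s = N := by
  subst h
  obtain ⟨l, rfl⟩ := Quot.exists_rep N
  exact ⟨l.get, (Fin.univ_val_map _).trans (congrArg _ (List.ofFn_get l))⟩

theorem linkTypes_eq_image_joinType [NeZero q] (hk : 1 ≤ k) (hq : k ≤ q + m) :
    linkTypes k q m = joinType '' {N | N.card = m + 1 ∧ (∀ σ ∈ N, 0 ∉ σ ∧ σ ≠ 0) ∧
      (N.map Multiset.sum).sum = k} := by
  ext c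
  constructor
  · intro hc
    obtain ⟨s, hs, hsum, rfl⟩ := exists_gapParts_of_mem_linkTypes hk hc
    refine ⟨_, ⟨by simp, fun σ hσ => ?_, by rwa [Multiset.map_map]⟩, rfl⟩
    obtain ⟨j, -, rfl⟩ := Multiset.mem_map.1 hσ
    exact hs j
  · rintro ⟨N, ⟨hcard, hN, hsum⟩, rfl⟩
    obtain ⟨s, rfl⟩ := exists_family_eq hcard
    rw [Multiset.map_map] at hsum
    exact joinType_mem_linkTypes hk hq
      (fun j => hN _ (Multiset.mem_map_of_mem s (Finset.mem_univ_val j))) hsum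

end LinkTypes

section Count

variable {k q m : ℕ} {M N : Multiset (Multiset ℕ)}

theorem weight_cons (σ : Multiset ℕ) (M : Multiset (Multiset ℕ)) :
    weight (σ ::ₘ M) = σ.sum - 1 + weight M := by
  simp [weight]

theorem weight_add (M N : Multiset (Multiset ℕ)) : weight (M + N) = weight M + weight N := by
  simp [weight]

theorem sum_map_sum_eq (hN : ∀ σ ∈ N, 0 ∉ σ ∧ σ ≠ 0) :
    (N.map Multiset.sum).sum = weight N + N.card := by
  induction N using Multiset.induction_on with
  | empty => rfl
  | cons σ N ih =>
    obtain ⟨hσ, hN⟩ := Multiset.forall_mem_cons.1 hN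
    have hpos := (Multiset.card_pos.2 hσ.2).trans_le (card_le_sum hσ.1)
    rw [Multiset.map_cons, Multiset.sum_cons, ih hN, weight_cons, Multiset.card_cons]
    omega

theorem weight_factors (σ : Multiset ℕ) : weight (factors σ) = σ.sum - 1 := by
  unfold factors
  split_ifs <;> simp [weight]

theorem weight_bind_factors (N : Multiset (Multiset ℕ)) : weight (N.bind factors) = weight N := by
  induction N using Multiset.induction_on with
  | empty => rfl
  | cons σ N ih => rw [Multiset.cons_bind, weight_add, weight_factors, ih, weight_cons]

theorem IsIndecomposable.factors_eq {σ : Multiset ℕ} (h : IsIndecomposable σ) :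
    factors σ = {σ} := by
  obtain ⟨-, h2 | rfl⟩ := h
  · exact if_pos h2
  · rfl

theorem bind_factors_eq_self (hM : ∀ σ ∈ M, IsIndecomposable σ) : M.bind factors = M := by
  rw [Multiset.bind_congr fun σ hσ => (hM σ hσ).factors_eq]
  exact (Multiset.bind_singleton M id).trans M.map_id

theorem card_le_weight (hM : ∀ σ ∈ M, IsIndecomposable σ) : M.card ≤ weight M := by
  have h := Multiset.card_nsmul_le_sum (s := M.map fun σ => σ.sum - 1) (a := 1) <|
    Multiset.forall_mem_map_iff.2 fun σ hσ => Nat.sub_pos_of_lt (hM σ hσ).two_le_sum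
  rwa [Multiset.card_map, smul_eq_mul, mul_one] at h

theorem linkTypes_eq_image_indecomposable [NeZero q] (hm : m < k) (hk : k ≤ 2 * m + 2)
    (hq : k ≤ q + m) : linkTypes k q m =
      joinType '' {M | (∀ σ ∈ M, IsIndecomposable σ) ∧ weight M = k - m - 1} := by
  rw [linkTypes_eq_image_joinType (by omega) hq]
  refine Set.Subset.antisymm ?_ ?_
  · rintro _ ⟨N, ⟨hcard, hN, hsum⟩, rfl⟩
    rw [sum_map_sum_eq hN] at hsum
    refine ⟨N.bind factors, ⟨fun σ hσ => ?_, ?_⟩, joinType_bind_factors hN⟩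
    · obtain ⟨τ, hτ, hστ⟩ := Multiset.mem_bind.1 hσ
      exact isIndecomposable_of_mem_factors (hN τ hτ).1 hστ
    · rw [weight_bind_factors]
      omega
  · rintro _ ⟨M, ⟨hM, hweight⟩, rfl⟩
    have hcard := card_le_weight hM
    -- `K_{1}` is empty, so copies of `{1}` can pad the family to `m + 1` members.
    let N := M + Multiset.replicate (m + 1 - M.card) {1}
    have hNcard : N.card = m + 1 := by
      rw [Multiset.card_add, Multiset.card_replicate]
      omega
    have hN : ∀ σ ∈ N, 0 ∉ σ ∧ σ ≠ 0 := fun σ hσ => by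
      rcases Multiset.mem_add.1 hσ with h | h
      · exact ⟨(hM σ h).1, (hM σ h).ne_zero⟩
      · rw [Multiset.eq_of_mem_replicate h]
        decide
    have hbind : N.bind factors = M := by
      have hone : (Multiset.replicate (m + 1 - M.card) {1}).bind factors = 0 :=
        (Multiset.bind_congr fun σ hσ => by rw [Multiset.eq_of_mem_replicate hσ]; rfl).trans
          (Multiset.bind_zero _)
      rw [Multiset.add_bind, bind_factors_eq_self hM, hone, add_zero]
    refine ⟨N, ⟨hNcard, hN, ?_⟩, by rw [← joinType_bind_factors hN, hbind]⟩
    rw [sum_map_sum_eq hN, ← weight_bind_factors, hbind]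
    omega

theorem setOf_indecomposable_weight_zero :
    {M | (∀ σ ∈ M, IsIndecomposable σ) ∧ weight M = 0} = {0} := by
  ext M
  refine ⟨fun ⟨hM, h⟩ => Multiset.card_eq_zero.1 (Nat.le_zero.1 (h ▸ card_le_weight hM)), ?_⟩
  rintro rfl
  exact ⟨fun σ hσ => absurd hσ (Multiset.notMem_zero σ), rfl⟩

theorem setOf_indecomposable_weight_succ (t : ℕ) :
    {M | (∀ σ ∈ M, IsIndecomposable σ) ∧ weight M = t + 1} =
      Multiset.cons {2} '' {M | (∀ σ ∈ M, IsIndecomposable σ) ∧ weight M = t} ∪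
        {M | (∀ σ ∈ M, IsMultipart σ) ∧ weight M = t + 1} := by
  have hpoint : IsIndecomposable {2} := ⟨by simp, Or.inr rfl⟩
  refine Set.Subset.antisymm ?_ (Set.union_subset ?_ ?_)
  · rintro M ⟨hM, hweight⟩
    by_cases h : ({2} : Multiset ℕ) ∈ M
    · obtain ⟨M, rfl⟩ := Multiset.exists_cons_of_mem h
      rw [weight_cons, Multiset.sum_singleton, add_comm, Nat.add_right_cancel_iff] at hweight
      exact Or.inl ⟨M, ⟨(Multiset.forall_mem_cons.1 hM).2, hweight⟩, rfl⟩
    · exact Or.inr ⟨fun σ hσ => ⟨(hM σ hσ).1, (hM σ hσ).2.resolve_right fun h2 => h (h2 ▸ hσ)⟩,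
        hweight⟩
  · rintro _ ⟨M, ⟨hM, rfl⟩, rfl⟩
    exact ⟨Multiset.forall_mem_cons.2 ⟨hpoint, hM⟩, (weight_cons _ _).trans (add_comm _ _)⟩
  · exact fun M hM => ⟨fun σ hσ => (hM.1 σ hσ).isIndecomposable, hM.2⟩

theorem encard_indecomposable_weight_eq (t : ℕ) :
    {M | (∀ σ ∈ M, IsIndecomposable σ) ∧ weight M = t}.encard = 1 + ∑ s ∈ Finset.range t, Q s := by
  induction t with
  | zero => rw [setOf_indecomposable_weight_zero, Set.encard_singleton]; rfl
  | succ t ih =>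
    rw [setOf_indecomposable_weight_succ, Set.encard_union_eq,
      Function.Injective.encard_image (fun _ _ => (Multiset.cons_inj_right _).1), ih,
      ← Q_eq_encard, Finset.sum_range_succ, add_assoc]
    refine Set.disjoint_left.2 ?_
    rintro _ ⟨M, -, rfl⟩ hM
    exact absurd (hM.1 _ (Multiset.mem_cons_self _ _)).2 (by simp)

theorem encard_linkTypes [NeZero q] (hm : m < k) (hk : k ≤ 2 * m + 2) (hq : k ≤ q + m) :
    (linkTypes k q m).encard = 1 + ∑ s ∈ Finset.range (k - m - 1), Q s := by
  rw [linkTypes_eq_image_indecomposable hm hk hq,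
    (joinType_injOn.mono fun M hM => hM.1).encard_image, encard_indecomposable_weight_eq]

theorem Q_eq_sum (s : ℕ) : Q s = ((∑ μ : (s + 1).Partition, ∏ n ∈ μ.parts.toFinset,
    Nat.multichoose (Fintype.card (n + 1).Partition - 1) (μ.parts.count n) : ℕ) : ℕ∞) :=
  (Q_eq_encard s).trans (encard_weight_eq (s + 1))

end Count

end EdgewiseSubdivision

theorem mainTheorem11_general :
    (∀ k q m : ℕ, m < k → k ≤ 2 * m + 2 → k ≤ q + m →
      (EdgewiseSubdivision.linkTypes k q m).encard =
        1 + ∑ s ∈ Finset.range (k - m - 1), EdgewiseSubdivision.Q s) ∧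
    (∀ s : ℕ, EdgewiseSubdivision.Q s =
      ((∑ μ : (s + 1).Partition, ∏ n ∈ μ.parts.toFinset,
        Nat.multichoose (Fintype.card (n + 1).Partition - 1) (μ.parts.count n) : ℕ) : ℕ∞)) := by
  refine ⟨fun k q m hm hk hq => ?_, EdgewiseSubdivision.Q_eq_sum⟩
  have : NeZero q := ⟨by omega⟩
  exact EdgewiseSubdivision.encard_linkTypes hm hk hq

theorem mainTheorem11 :
    (∀ m : ℕ, (EdgewiseSubdivision.linkTypes (2 * m + 2) (2 * m + 2) m).encard =
      1 + ∑ s ∈ Finset.range (m + 1), EdgewiseSubdivision.Q s) ∧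
    (∀ s : ℕ, EdgewiseSubdivision.Q s =
      ((∑ μ : (s + 1).Partition, ∏ n ∈ μ.parts.toFinset,
        Nat.multichoose (Fintype.card (n + 1).Partition - 1) (μ.parts.count n) : ℕ) : ℕ∞)) := by
  refine ⟨fun m => ?_, mainTheorem11_general.2⟩
  have h := mainTheorem11_general.1 (2 * m + 2) (2 * m + 2) m (by omega) (by omega) (by omega)
  rwa [show 2 * m + 2 - m - 1 = m + 1 by omega] at h
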